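/- Let $K$ be an algebraically closed field. A Brauer graph is a finite connected graph $G$ with at least one edge (loops and multiple edges allowed), together with a cyclic ordering of the half-edges around each vertex $v$ and an arbitrary multiplicity $m(v)\ge 1$ at each vertex $v$. A half-edge is truncated if its vertex $v$ satisfies $m(v)\,\mathrm{val}(v)=1$. The Brauer graph algebra $A=KQ/I$ of $G$ is defined as follows. The vertices of the quiver $Q$ are the edges of $G$. Each non-truncated half-edge $h$ gives an arrow from the edge of $h$ to the edge of the successor of $h$ in the cyclic ordering; if $G$ is a single edge with both ends truncated, then by convention $Q$ is one vertex with one loop. For the arrow $a$ of a half-edge at $v$, let $C_a$ be the special cycle at $a$: the product of the arrows once around $v$, starting with $a$. The ideal $I$ is generated by: (I) $C_a^{m(v)}-C_b^{m(w)}$, whenever the two half-edges of an edge, at $v$ and $w$, give arrows $a$ and $b$; (II) $C_a^{m(v)}a$, whenever $a$ is the only arrow given by the half-edges of its edge; (III) all paths $ab$ of length two that do not turn around a vertex of $G$, i.e. for which the half-edge of $b$ is the one opposite to the successor of the half-edge of $a$. Let $A=KQ/I$ be a Brauer graph algebra. Then the first Hochschild cohomology $\mathrm{HH}^1(A)=\mathrm{Der}_K(A)/\mathrm{Inn}(A)$,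 with the bracket induced by the commutator of derivations, is a solvable Lie algebra, except possibly in the following cases: 1. $\mathrm{char}(K)\ne 2$ and $A$ is derived equivalent to the trivial extension $T(\Lambda)=\Lambda\ltimes \mathrm{Hom}_K(\Lambda,K)$ of the Kronecker algebra $\Lambda$ (the path algebra of the quiver with two vertices and two arrows from the first to the second); 2. $\mathrm{char}(K)=2$ and there is a loop $\alpha$ in $Q$ with $\alpha^2=0$ in $A$; 3. $\mathrm{char}(K)\neq 2$ and $A\cong K[X]/(X^r)$ for some $r\ge 1$ divisible by $\mathrm{char}(K)$. -/

import Mathlib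

open CategoryTheory
open scoped Polynomial

universe u

/-! ### First Hochschild cohomology as a Lie algebra -/

section Hochschild

variable (K A : Type*) [Field K] [Ring A] [Algebra K A]

/-- The commutator bracket on `End_K(A)`. -/
abbrev endLieRing : LieRing (Module.End K A) := LieRing.ofAssociativeRing

attribute [local instance] endLieRing

/-- The Lie algebra `Der_K(A)` of `K`-linear derivations of a (not necessarily commutative)
algebra, a Lie subalgebra of `End_K(A)` with the commutator bracket. -/
def algDer : LieSubalgebra K (Module.End K A) where
  carrier := {d | ∀ a b : A, d (a * b) = d a * b + a * d b}
  add_mem' := by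
    intro d d' hd hd' a b
    simp only [Set.mem_ofPred_eq] at hd hd'
    simp only [LinearMap.add_apply, hd, hd', add_mul, mul_add]
    abel
  zero_mem' := by intro a b; simp
  smul_mem' := by
    intro c d hd a b
    simp only [Set.mem_ofPred_eq] at hd
    simp [hd]
  lie_mem' := by
    intro d d' hd hd' a b
    have h : ∀ x y : A, d (x * y) = d x * y + x * d y := hd
    have h' : ∀ x y : A, d' (x * y) = d' x * y + x * d' y := hd'
    simp only [Ring.lie_def, LinearMap.sub_apply, Module.End.mul_apply, h, h', map_add,
      sub_mul, mul_sub]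
    abel

theorem inner_mem_algDer (a : A) :
    LinearMap.mulLeft K a - LinearMap.mulRight K a ∈ algDer K A := by
  intro x y
  simp only [LinearMap.sub_apply, LinearMap.mulLeft_apply, LinearMap.mulRight_apply, sub_mul,
    mul_sub, mul_assoc]
  abel

/-- The ideal `Inn(A)` of inner derivations `x ↦ a * x - x * a`. -/
def algInn : LieIdeal K (algDer K A) where
  carrier := {d | ∃ a : A, (d : Module.End K A) = LinearMap.mulLeft K a - LinearMap.mulRight K a}
  add_mem' := by
    rintro d d' ⟨a, ha⟩ ⟨a', ha'⟩
    refine ⟨a + a', ?_⟩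
    ext x
    simp [ha, ha', add_mul, mul_add]
    abel
  zero_mem' := ⟨0, by ext x; simp⟩
  smul_mem' := by
    rintro c d ⟨a, ha⟩
    refine ⟨c • a, ?_⟩
    ext x
    simp [ha, smul_sub]
  lie_mem := by
    rintro d d' ⟨a, ha⟩
    have h : ∀ x y : A, (d : Module.End K A) (x * y) =
        (d : Module.End K A) x * y + x * (d : Module.End K A) y := d.2
    refine ⟨(d : Module.End K A) a, ?_⟩
    ext x
    simp only [LieSubalgebra.coe_bracket, ha, Ring.lie_def, LinearMap.sub_apply,
      Module.End.mul_apply, LinearMap.mulLeft_apply, LinearMap.mulRight_apply, map_sub, h]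
    abel

/-- The Lie algebra `HH¹(A) = Der_K(A) / Inn(A)`. -/
abbrev HH1 : Type _ := algDer K A ⧸ algInn K A

end Hochschild

/-! ### Path algebras -/

section PathAlgebra

variable (K : Type*) [Field K] {Q₀ Q₁ : Type*} [Fintype Q₀] (src tgt : Q₁ → Q₀)

/-- The defining relations of the path algebra of the quiver with finite vertex set `Q₀`, arrow
set `Q₁` and source and target maps `src`, `tgt`: the vertices form a complete set of orthogonal
idempotents, and `a = e_{src a} a e_{tgt a}` for every arrow `a` (a product of arrows is read from
left to right). -/
inductive PathAlgebra.Rel : FreeAlgebra K (Q₀ ⊕ Q₁) → FreeAlgebra K (Q₀ ⊕ Q₁) → Prop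
  | idem (i : Q₀) : Rel (FreeAlgebra.ι K (Sum.inl i) * FreeAlgebra.ι K (Sum.inl i))
      (FreeAlgebra.ι K (Sum.inl i))
  | orth (i j : Q₀) (hij : i ≠ j) :
      Rel (FreeAlgebra.ι K (Sum.inl i) * FreeAlgebra.ι K (Sum.inl j)) 0
  | sum_eq_one : Rel (∑ i : Q₀, FreeAlgebra.ι K (Sum.inl i)) 1
  | src_mul (a : Q₁) : Rel (FreeAlgebra.ι K (Sum.inl (src a)) * FreeAlgebra.ι K (Sum.inr a))
      (FreeAlgebra.ι K (Sum.inr a))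
  | mul_tgt (a : Q₁) : Rel (FreeAlgebra.ι K (Sum.inr a) * FreeAlgebra.ι K (Sum.inl (tgt a)))
      (FreeAlgebra.ι K (Sum.inr a))

/-- The path algebra `KQ`. -/
abbrev PathAlgebra : Type _ := RingQuot (PathAlgebra.Rel K src tgt)

/-- An arrow, as an element of the path algebra. -/
noncomputable def PathAlgebra.arrow (a : Q₁) : PathAlgebra K src tgt :=
  RingQuot.mkAlgHom K (PathAlgebra.Rel K src tgt) (FreeAlgebra.ι K (Sum.inr a))

end PathAlgebra

/-! ### The trivial extension of the Kronecker algebra -/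

section TrivialExtension

variable (K A : Type*) [Field K] [Ring A] [Algebra K A]

/-- The `K`-dual `Hom_K(A, K)`, with the `A`-bimodule structure `(a f b)(x) = f (b x a)`. -/
def DualBimodule : Type _ := Module.Dual K A

namespace DualBimodule

/-- A functional in the dual bimodule, as a linear map. -/
def toDual (f : DualBimodule K A) : A →ₗ[K] K := f

noncomputable instance : AddCommGroup (DualBimodule K A) :=
  inferInstanceAs (AddCommGroup (Module.Dual K A))

noncomputable instance : Module K (DualBimodule K A) :=
  inferInstanceAs (Module K (Module.Dual K A))

noncomputable instance : Module A (DualBimodule K A) where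
  smul a f := LinearMap.comp (toDual K A f) (LinearMap.mulRight K a)
  one_smul f := LinearMap.ext fun x => congrArg (toDual K A f) (mul_one x)
  mul_smul a b f := LinearMap.ext fun x => congrArg (toDual K A f) (mul_assoc x a b).symm
  smul_zero _ := LinearMap.ext fun _ => rfl
  smul_add _ _ _ := LinearMap.ext fun _ => rfl
  add_smul a b f := LinearMap.ext fun x =>
    (congrArg (toDual K A f) (mul_add x a b)).trans (map_add (toDual K A f) _ _)
  zero_smul f := LinearMap.ext fun x =>
    (congrArg (toDual K A f) (mul_zero x)).trans (map_zero (toDual K A f))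

noncomputable instance : Module Aᵐᵒᵖ (DualBimodule K A) where
  smul b f := LinearMap.comp (toDual K A f) (LinearMap.mulLeft K b.unop)
  one_smul f := LinearMap.ext fun x => congrArg (toDual K A f) (one_mul x)
  mul_smul a b f := LinearMap.ext fun x => congrArg (toDual K A f) (mul_assoc b.unop a.unop x)
  smul_zero _ := LinearMap.ext fun _ => rfl
  smul_add _ _ _ := LinearMap.ext fun _ => rfl
  add_smul a b f := LinearMap.ext fun x =>
    (congrArg (toDual K A f) (add_mul a.unop b.unop x)).trans (map_add (toDual K A f) _ _)
  zero_smul f := LinearMap.ext fun x =>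
    (congrArg (toDual K A f) (zero_mul x)).trans (map_zero (toDual K A f))

instance : SMulCommClass A Aᵐᵒᵖ (DualBimodule K A) where
  smul_comm a b f := LinearMap.ext fun x =>
    congrArg (toDual K A f) (mul_assoc b.unop x a).symm

instance : IsScalarTower K A (DualBimodule K A) where
  smul_assoc c a f := LinearMap.ext fun x =>
    (congrArg (toDual K A f) (mul_smul_comm c x a)).trans (map_smul (toDual K A f) c _)

instance : IsScalarTower K Aᵐᵒᵖ (DualBimodule K A) where
  smul_assoc c b f := LinearMap.ext fun x =>
    (congrArg (toDual K A f) (smul_mul_assoc c b.unop x)).trans (map_smul (toDual K A f) c _)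

end DualBimodule

/-- The trivial extension algebra `T(A) = A ⋉ Hom_K(A, K)`. -/
abbrev TrivialExtension : Type _ := TrivSqZeroExt A (DualBimodule K A)

end TrivialExtension

/-- The Kronecker algebra: the path algebra of the quiver with two vertices `0`, `1` and two
arrows from `0` to `1`. -/
abbrev KroneckerAlgebra (K : Type*) [Field K] : Type _ :=
  PathAlgebra K (Q₀ := Fin 2) (Q₁ := Fin 2) (fun _ => 0) (fun _ => 1)

/-! ### Derived equivalence -/

/-- Two `K`-algebras are derived equivalent if the derived categories of their module categories
are equivalent as `K`-linear triangulated categories. -/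
def DerivedEquivalent (K A B : Type u) [Field K] [Ring A] [Algebra K A] [Ring B]
    [Algebra K B] : Prop :=
  letI := HasDerivedCategory.standard (ModuleCat.{u} A)
  letI := HasDerivedCategory.standard (ModuleCat.{u} B)
  ∃ (F : DerivedCategory (ModuleCat.{u} A) ⥤ DerivedCategory (ModuleCat.{u} B))
    (_ : F.CommShift ℤ), F.IsTriangulated ∧ F.IsEquivalence ∧
      ∃ _ : F.Additive, Functor.Linear K F

/-! ### Brauer graph algebras -/

/-- A Brauer graph with vertex set `V` and edge set `E` (loops and multiple edges are allowed):
a non-empty connected graph with a cyclic ordering of the half-edges around each vertex and a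
multiplicity `≥ 1` at each vertex. The two half-edges of the edge `e` are `(e, false)` and
`(e, true)`, and `endpoint h` is the vertex to which the half-edge `h` is attached. The cyclic
orderings are recorded by the permutation `next`, whose cycles (including the fixed points) are
the sets of half-edges at the vertices. -/
structure BrauerGraph (V E : Type) where
  endpoint : E × Bool → V
  next : Equiv.Perm (E × Bool)
  sameCycle_iff : ∀ h h', next.SameCycle h h' ↔ endpoint h = endpoint h'
  mult : V → ℕ
  mult_pos : ∀ v, 0 < mult v
  nonempty : Nonempty E
  connected : ∀ v w, Relation.ReflTransGen
    (fun a b => ∃ (e : E) (i : Bool), endpoint (e, i) = a ∧ endpoint (e, !i) = b) v w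

namespace BrauerGraph

variable {V E : Type} (G : BrauerGraph V E)

/-- The other half of the same edge. -/
def flip (h : E × Bool) : E × Bool := (h.1, !h.2)

/-- The valency of a vertex (a loop is counted twice). -/
noncomputable def val (v : V) : ℕ := Nat.card {h // G.endpoint h = v}

/-- The half-edge `h` is truncated if its vertex has valency one and multiplicity one. -/
def Truncated (h : E × Bool) : Prop := G.val (G.endpoint h) * G.mult (G.endpoint h) = 1

/-- The half-edges that give an arrow of the quiver: the non-truncated ones. The only exception is
the graph with a single edge both of whose ends are truncated; its quiver is by convention a single
loop (with relation `x ^ 2 = 0`), and we keep one of the two half-edges for it. -/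
def IsArrow (h : E × Bool) : Prop :=
  ¬ G.Truncated h ∨ (G.Truncated (flip h) ∧ h.2 = false)

/-- The arrows of the quiver of a Brauer graph; the vertices of the quiver are the edges of the
graph. -/
def Arrow : Type := {h : E × Bool // G.IsArrow h}

theorem endpoint_next (h : E × Bool) : G.endpoint (G.next h) = G.endpoint h :=
  ((G.sameCycle_iff h (G.next h)).1 ⟨1, by simp⟩).symm

theorem isArrow_next {h : E × Bool} (hh : G.IsArrow h) : G.IsArrow (G.next h) := by
  by_cases ht : G.Truncated h
  · have h1 : G.val (G.endpoint h) = 1 := Nat.eq_one_of_mul_eq_one_right ht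
    have h2 : Subsingleton {h' // G.endpoint h' = G.endpoint h} :=
      (Nat.card_eq_one_iff_unique.1 h1).1
    have h3 : G.next h = h := congrArg Subtype.val
      (Subsingleton.elim (⟨G.next h, G.endpoint_next h⟩ : {h' // G.endpoint h' = G.endpoint h})
        ⟨h, rfl⟩)
    rwa [h3]
  · left
    unfold Truncated at ht ⊢
    rwa [G.endpoint_next h]

namespace Arrow

variable {G}

/-- The arrow given by the half-edge `h` goes from the edge of `h` to the edge of its successor. -/
def src (a : G.Arrow) : E := a.1.1

/-- The arrow given by the half-edge `h` goes from the edge of `h` to the edge of its successor. -/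
def tgt (a : G.Arrow) : E := (G.next a.1).1

/-- The next arrow around the same vertex of the Brauer graph. -/
def next (a : G.Arrow) : G.Arrow := ⟨G.next a.1, G.isArrow_next a.2⟩

/-- The vertex of the Brauer graph around which the arrow turns. -/
def vertex (a : G.Arrow) : V := G.endpoint a.1

end Arrow

variable (K : Type*) [Field K] [Fintype E]

/-- The path algebra of the quiver of the Brauer graph. -/
abbrev KQ : Type _ := PathAlgebra K (Arrow.src (G := G)) (Arrow.tgt (G := G))

/-- The special cycle starting with `a`: the product of the arrows `a`, `a.next`, … once around
the vertex of `a`. -/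
noncomputable def specialCycle (a : G.Arrow) : G.KQ K :=
  ((List.range (G.val a.vertex)).map
    fun i => PathAlgebra.arrow K Arrow.src Arrow.tgt (Arrow.next^[i] a)).prod

/-- The relations of the Brauer graph algebra.
(I) At an edge both of whose half-edges give arrows, the powers of the two special cycles by the
respective multiplicities are equal.
(II) At an edge with only one arrow `a`, the power of the special cycle of `a` by the
multiplicity, followed by `a`, is zero.
(III) A path `a b` of length two which does not turn around a vertex of the Brauer graph is zero:
here `b` starts with the half-edge opposite to the successor of the half-edge of `a`. -/
inductive Rel : G.KQ K → G.KQ K → Prop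
  | cycle (a b : G.Arrow) (hab : b.1 = flip a.1) :
      Rel (G.specialCycle K a ^ G.mult a.vertex) (G.specialCycle K b ^ G.mult b.vertex)
  | overlong (a : G.Arrow) (ha : ¬ G.IsArrow (flip a.1)) :
      Rel (G.specialCycle K a ^ G.mult a.vertex * PathAlgebra.arrow K Arrow.src Arrow.tgt a) 0
  | turn (a b : G.Arrow) (hab : b.1 = flip (G.next a.1)) :
      Rel (PathAlgebra.arrow K Arrow.src Arrow.tgt a * PathAlgebra.arrow K Arrow.src Arrow.tgt b) 0

/-- The Brauer graph algebra `A = KQ/I`. -/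
abbrev Alg : Type _ := RingQuot (G.Rel K)

/-- The image of an arrow in the Brauer graph algebra. -/
noncomputable def arrow (a : G.Arrow) : G.Alg K :=
  RingQuot.mkAlgHom K (G.Rel K) (PathAlgebra.arrow K Arrow.src Arrow.tgt a)

end BrauerGraph

/-! Modulo inner derivations every derivation `d` of `A` kills the idempotents of the edges. Suppose
that every such `d` also sends arrows into the ideal generated by the arrows, the radical. Then `d`
preserves the powers of the radical and acts on rad/rad² by a matrix indexed by the arrows, its
linear part. Derivations with zero linear part raise the radical degree; since the radical is
nilpotent, repeated brackets of them vanish. So it is enough that the linear parts lie in a solvable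
Lie algebra of matrices (`isSolvable_HH1_of_linearPart`).

Entries of the linear part between non-parallel arrows are zero, and at most two arrows start at an
edge, so there are blocks of size at most two. In characteristic two this suffices, because gl₂ is
then solvable (`exists_chain_of_two_eq_zero`). In the other characteristics, let the length of an
arrow be the length of the maximal path starting with it. The entry at distinct arrows `a`, `b` can
be nonzero only if `b` has length two (`coeff_derivation_of_three_le`). The blocks are therefore
triangular unless two parallel arrows both have length two. If these are not loops, the graph is a
double edge and `A` is isomorphic to the trivial extension of the Kronecker algebra
(`IsDoubleEdge.nonempty_algEquiv`), which is excluded. If they are loops, the algebra is local with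
radical cube zero, and the relations force the linear parts to commute or to be diagonal
(`isSolvable_of_local`).

The radical can fail to be preserved only at a loop `a`. If `a` is followed by the opposite
half-edge, then `a² = 0` and differentiating gives twice the constant term of `d a`, so only
characteristic two is a problem, and there such loops are excluded. If `a` is followed by itself, a
second arrow at its edge forces the constant term to vanish. Without a second arrow `A` is a
truncated polynomial algebra K[X]/(X^r), treated directly: either r is invertible, or the
characteristic is two and the Lie algebra is solvable even though the radical may move, or the case
is excluded. -/

/-! ### Derived equivalences from isomorphisms of algebras. -/

/-- The induced equivalence of categories of complexes preserves and reflects quasi-isomorphisms, so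
it descends to an equivalence of the localizations. -/
theorem CategoryTheory.Functor.mapDerivedCategory_isEquivalence
    {C D : Type*} [Category C] [Category D] [Abelian C] [Abelian D]
    [HasDerivedCategory C] [HasDerivedCategory D]
    (e : C ≌ D) [e.functor.Additive] :
    e.functor.mapDerivedCategory.IsEquivalence := by
  have : (e.functor.mapHomologicalComplex (ComplexShape.up ℤ)).IsEquivalence :=
    (e.mapHomologicalComplex (ComplexShape.up ℤ)).isEquivalence_functor
  have : (e.functor.mapHomologicalComplexUpToQuasiIsoLocalizerMorphism
      (ComplexShape.up ℤ)).functor.IsEquivalence := this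
  have : (e.functor.mapHomologicalComplexUpToQuasiIsoLocalizerMorphism
      (ComplexShape.up ℤ)).IsInduced := by
    constructor
    ext X Y f
    exact HomologicalComplex.quasiIso_map_iff_of_preservesHomology f e.functor
  have := LocalizerMorphism.isLocalizedEquivalence_of_isInduced
    (e.functor.mapHomologicalComplexUpToQuasiIsoLocalizerMorphism (ComplexShape.up ℤ))
  have : CatCommSq (e.functor.mapHomologicalComplexUpToQuasiIsoLocalizerMorphism
      (ComplexShape.up ℤ)).functor DerivedCategory.Q DerivedCategory.Q
      e.functor.mapDerivedCategory := ⟨e.functor.mapDerivedCategoryFactors.symm⟩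
  exact LocalizerMorphism.isEquivalence
    (e.functor.mapHomologicalComplexUpToQuasiIsoLocalizerMorphism (ComplexShape.up ℤ))
    DerivedCategory.Q DerivedCategory.Q _

/-- The excluded Kronecker case is met through an actual isomorphism with the trivial extension, so
this is all that is needed about derived equivalence. -/
theorem derivedEquivalent_of_algEquiv {K A B : Type u} [Field K] [Ring A] [Algebra K A] [Ring B]
    [Algebra K B] (f : A ≃ₐ[K] B) : DerivedEquivalent K A B := by
  let := HasDerivedCategory.standard (ModuleCat.{u} A)
  let := HasDerivedCategory.standard (ModuleCat.{u} B)
  let e : ModuleCat.{u} A ≌ ModuleCat.{u} B :=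
    ModuleCat.restrictScalarsEquivalenceOfRingEquiv f.symm.toRingEquiv
  have : e.functor.Additive := inferInstanceAs
    (ModuleCat.restrictScalars (f.symm.toRingEquiv : B →+* A)).Additive
  have : e.functor.Linear K := by
    constructor
    intro M N g c
    ext m
    exact congr_arg (· • g.hom m) (f.symm.commutes c).symm
  exact ⟨e.functor.mapDerivedCategory, inferInstance, inferInstance,
    Functor.mapDerivedCategory_isEquivalence e, inferInstance, inferInstance⟩

/-! ### Solvability criteria for the first Hochschild cohomology. -/

section HochschildSolvable

variable {K A : Type*} [Field K] [Ring A] [Algebra K A]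

attribute [local instance] endLieRing

/-- A Lie algebra with a descending chain of submodules, each containing the brackets of the
previous one, is solvable. -/
theorem LieAlgebra.isSolvable_of_chain {L : Type*} [LieRing L] [LieAlgebra K L]
    (P : ℕ → Submodule K L) (h0 : P 0 = ⊤)
    (hP : ∀ n, ∀ x ∈ P n, ∀ y ∈ P n, ⁅x, y⁆ ∈ P (n + 1)) (N : ℕ) (hN : P N = ⊥) :
    LieAlgebra.IsSolvable L := by
  have key : ∀ n, (LieAlgebra.derivedSeries K L n).toSubmodule ≤ P n := by
    intro n
    induction n with
    | zero => simp [h0]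
    | succ n ih =>
      rw [LieAlgebra.derivedSeries_def, LieAlgebra.derivedSeriesOfIdeal_succ,
        LieSubmodule.lieIdeal_oper_eq_linear_span', Submodule.span_le]
      rintro _ ⟨x, hx, y, hy, rfl⟩
      exact hP n x (ih hx) y (ih hy)
  refine LieAlgebra.IsSolvable.mk (R := K) (k := N) ?_
  rw [← LieSubmodule.toSubmodule_eq_bot, eq_bot_iff, ← hN]
  exact key N

/-- This moves the chain condition from classes to representatives: `Q 0` only has to meet every
class modulo inner derivations, and its members need not be derivations. -/
theorem isSolvable_HH1_of_chain (Q : ℕ → Submodule K (Module.End K A))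
    (h0 : ∀ d ∈ algDer K A, ∃ a, d - (LinearMap.mulLeft K a - LinearMap.mulRight K a) ∈ Q 0)
    (hQ : ∀ n, ∀ d ∈ algDer K A, ∀ d' ∈ algDer K A, d ∈ Q n → d' ∈ Q n →
      d * d' - d' * d ∈ Q (n + 1)) (N : ℕ) (hN : Q N = ⊥) :
    LieAlgebra.IsSolvable (HH1 K A) := by
  let P : ℕ → Submodule K (HH1 K A) := fun n =>
    ((Q n).comap (algDer K A).toSubmodule.subtype).map (algInn K A).toSubmodule.mkQ
  refine LieAlgebra.isSolvable_of_chain P ?_ ?_ N ?_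
  · rw [eq_top_iff]
    rintro x -
    obtain ⟨d, rfl⟩ := Submodule.mkQ_surjective (algInn K A).toSubmodule x
    obtain ⟨a, ha⟩ := h0 d.1 d.2
    refine ⟨d - ⟨_, inner_mem_algDer K A a⟩, ha, ?_⟩
    rw [map_sub, sub_eq_self]
    exact (Submodule.Quotient.mk_eq_zero _).2 ⟨a, rfl⟩
  · rintro n _ ⟨d, hd, rfl⟩ _ ⟨d', hd', rfl⟩
    exact ⟨⁅d, d'⁆, hQ n d.1 d.2 d'.1 d'.2 hd hd', rfl⟩
  · rw [eq_bot_iff]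
    rintro _ ⟨d, hd, rfl⟩
    have : d = 0 := Subtype.ext ((Submodule.mem_bot K).1 (hN ▸ hd : d.1 ∈ (⊥ : Submodule K _)))
    simp [this]

variable {E : Type*} [Fintype E]

/-- Up to an inner derivation, a derivation kills a complete set of orthogonal idempotents. -/
theorem exists_sub_inner_apply_eq_zero [DecidableEq E] {e : E → A}
    (hmul : ∀ i j, e i * e j = if i = j then e i else 0) (hsum : ∑ i, e i = 1)
    {d : Module.End K A} (hd : d ∈ algDer K A) :
    ∃ a, ∀ j, (d - (LinearMap.mulLeft K a - LinearMap.mulRight K a) : Module.End K A) (e j) = 0 := by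
  have h : ∀ x y, d (x * y) = d x * y + x * d y := hd
  -- Differentiating `e j * e i` turns `e j * d (e i) * e i` into `d (e i) * e i` for `i = j`, minus
  -- `d (e j) * e i`. Summing over `i` shows that the commutator of this element with `e j` is `d (e
  -- j)`.
  refine ⟨∑ i, d (e i) * e i, fun j => ?_⟩
  have h1 : ∀ i, e j * d (e i) = (if j = i then d (e j) else 0) - d (e j) * e i := by
    intro i
    rw [eq_sub_iff_add_eq', ← h, hmul]
    split_ifs <;> simp
  simp only [LinearMap.sub_apply, LinearMap.mulLeft_apply, LinearMap.mulRight_apply,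
    Finset.sum_mul, Finset.mul_sum, mul_assoc, hmul]
  simp only [← mul_assoc, h1, sub_mul]
  simp only [mul_assoc, hmul]
  simp [← Finset.mul_sum, hsum, ite_mul]

/-- The sum of the powers `X ^ k` for `k ≥ n`. -/
def powersFrom (X : Submodule K A) (n : ℕ) : Submodule K A := ⨆ k, X ^ (n + k)

theorem pow_le_powersFrom (X : Submodule K A) {n k : ℕ} (h : n ≤ k) : X ^ k ≤ powersFrom X n := by
  obtain ⟨j, rfl⟩ := Nat.exists_eq_add_of_le h
  exact le_iSup (fun k => X ^ (n + k)) j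

theorem powersFrom_le {X : Submodule K A} {n : ℕ} {Y : Submodule K A}
    (h : ∀ k, n ≤ k → X ^ k ≤ Y) : powersFrom X n ≤ Y :=
  iSup_le fun k => h _ (Nat.le_add_right n k)

theorem powersFrom_antitone (X : Submodule K A) : Antitone (powersFrom X) := fun _ _ h =>
  powersFrom_le fun _ hk => pow_le_powersFrom X (h.trans hk)

theorem powersFrom_mul_le (X : Submodule K A) (m n : ℕ) :
    powersFrom X m * powersFrom X n ≤ powersFrom X (m + n) := by
  simp only [powersFrom, Submodule.iSup_mul, Submodule.mul_iSup]
  refine iSup_le fun i => iSup_le fun j => ?_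
  rw [← pow_add]
  exact pow_le_powersFrom X (by omega)

theorem mul_mem_powersFrom {X : Submodule K A} {m n : ℕ} {a b : A} (ha : a ∈ powersFrom X m)
    (hb : b ∈ powersFrom X n) : a * b ∈ powersFrom X (m + n) :=
  powersFrom_mul_le X m n (Submodule.mul_mem_mul ha hb)

theorem powersFrom_le_sup (X : Submodule K A) (n : ℕ) :
    powersFrom X n ≤ X ^ n ⊔ powersFrom X (n + 1) := by
  refine powersFrom_le fun k hk => ?_
  rcases hk.eq_or_lt with rfl | h
  · exact le_sup_left
  · exact (pow_le_powersFrom X h).trans le_sup_right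

/-- A derivation raising the degree of the elements of `X` by `n` does so for all `X ^ k`. -/
theorem derivation_mem_powersFrom {X : Submodule K A} {d : Module.End K A} (hd : d ∈ algDer K A)
    {n : ℕ} (hX : ∀ x ∈ X, d x ∈ powersFrom X (n + 1)) {k : ℕ} {y : A} (hy : y ∈ powersFrom X k) :
    d y ∈ powersFrom X (k + n) := by
  have h : ∀ x y, d (x * y) = d x * y + x * d y := hd
  have h1 : d 1 = 0 := by simpa using h 1 1
  have key : ∀ k, X ^ k ≤ (powersFrom X (k + n)).comap d := by
    intro k
    induction k with
    | zero =>
      rw [pow_zero, Submodule.one_le]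
      simp [h1]
    | succ k ih =>
      rw [pow_succ, Submodule.mul_le]
      intro a ha b hb
      rw [Submodule.mem_comap, h]
      refine add_mem ?_ ?_
      · have := mul_mem_powersFrom (ih ha)
          (pow_le_powersFrom X le_rfl (by simpa using hb : b ∈ X ^ 1))
        rwa [show k + n + 1 = k + 1 + n by ring] at this
      · have := mul_mem_powersFrom (pow_le_powersFrom X le_rfl ha) (hX b hb)
        rwa [show k + (n + 1) = k + 1 + n by ring] at this
  exact (powersFrom_le (Y := (powersFrom X (k + n)).comap d) fun j hj => (key j).trans
    (Submodule.comap_mono (powersFrom_antitone X (by omega)))) hy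

/-- The matrix of the linear part of an endomorphism, with respect to arrows `x` and
coefficient functionals `φ`. -/
def linearPart {Q : Type*} (x : Q → A) (φ : Q → A →ₗ[K] K) : Module.End K A →ₗ[K] Matrix Q Q K where
  toFun d := Matrix.of fun a b => φ b (d (x a))
  map_add' d d' := by ext; simp
  map_smul' c d := by ext; simp

theorem linearPart_apply {Q : Type*} (x : Q → A) (φ : Q → A →ₗ[K] K) (d : Module.End K A) (a b : Q) :
    linearPart x φ d a b = φ b (d (x a)) := rfl

section Quiver

variable {Q : Type*} [DecidableEq E] {e : E → A} {x : Q → A} {s t : Q → E}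

/-- An algebra generated by orthogonal idempotents and arrows between them is spanned by the
idempotents and the products of arrows. -/
theorem span_sup_powersFrom_eq_top (hmul : ∀ i j, e i * e j = if i = j then e i else 0)
    (hsum : ∑ i, e i = 1) (hs : ∀ a, e (s a) * x a = x a) (ht : ∀ a, x a * e (t a) = x a)
    (hgen : Algebra.adjoin K (Set.range e ∪ Set.range x) = ⊤) :
    Submodule.span K (Set.range e) ⊔ powersFrom (Submodule.span K (Set.range x)) 1 = ⊤ := by
  set S := Submodule.span K (Set.range e)
  set X := Submodule.span K (Set.range x)
  have heS : ∀ i, e i ∈ S := fun i => Submodule.subset_span ⟨i, rfl⟩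
  have hxX : ∀ a, x a ∈ X := fun a => Submodule.subset_span ⟨a, rfl⟩
  have hes : ∀ i a, e i * x a = if i = s a then x a else 0 := by
    intro i a
    rw [← hs a, ← mul_assoc, hmul]
    split_ifs with h <;> simp [h, hs]
  have het : ∀ a i, x a * e i = if t a = i then x a else 0 := by
    intro a i
    rw [← ht a, mul_assoc, hmul]
    split_ifs with h <;> simp [h]
  have hSX : S * X ≤ X := by
    rw [Submodule.span_mul_span, Submodule.span_le]
    rintro _ ⟨_, ⟨i, rfl⟩, _, ⟨a, rfl⟩, rfl⟩
    simp only [hes]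
    split_ifs
    · exact hxX a
    · exact zero_mem _
  have hXS : X * S ≤ X := by
    rw [Submodule.span_mul_span, Submodule.span_le]
    rintro _ ⟨_, ⟨a, rfl⟩, _, ⟨i, rfl⟩, rfl⟩
    simp only [het]
    split_ifs
    · exact hxX a
    · exact zero_mem _
  have hSS : S * S ≤ S := by
    rw [Submodule.span_mul_span, Submodule.span_le]
    rintro _ ⟨_, ⟨a, rfl⟩, _, ⟨i, rfl⟩, rfl⟩
    simp only [hmul]
    split_ifs
    · exact heS a
    · exact zero_mem _
  have hSF : S * powersFrom X 1 ≤ powersFrom X 1 := by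
    rw [powersFrom, Submodule.mul_iSup]
    refine iSup_mono fun k => ?_
    rw [add_comm, pow_succ', ← mul_assoc]
    exact mul_le_mul' hSX le_rfl
  have hFS : powersFrom X 1 * S ≤ powersFrom X 1 := by
    rw [powersFrom, Submodule.iSup_mul]
    refine iSup_mono fun k => ?_
    rw [add_comm, pow_succ, mul_assoc]
    exact mul_le_mul' le_rfl hXS
  -- The sum is closed under multiplication because idempotents send arrows to arrows or to zero; it
  -- contains the generators, hence is everything.
  let B : Subalgebra K A := (S ⊔ powersFrom X 1).toSubalgebra
    (Submodule.mem_sup_left (hsum ▸ Submodule.sum_mem _ fun i _ => heS i))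
    (by
      have : (S ⊔ powersFrom X 1) * (S ⊔ powersFrom X 1) ≤ S ⊔ powersFrom X 1 := by
        simp only [Submodule.sup_mul, Submodule.mul_sup]
        refine sup_le (sup_le (hSS.trans le_sup_left) (hFS.trans le_sup_right))
          (sup_le (hSF.trans le_sup_right) (((powersFrom_mul_le X 1 1).trans
            (powersFrom_antitone X (by omega))).trans le_sup_right))
      exact fun a b ha hb => this (Submodule.mul_mem_mul ha hb))
  have hB : B = ⊤ := by
    rw [eq_top_iff, ← hgen, Algebra.adjoin_le_iff]
    rintro _ (⟨i, rfl⟩ | ⟨a, rfl⟩)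
    · exact Submodule.mem_sup_left (heS i)
    · exact Submodule.mem_sup_right (pow_le_powersFrom X le_rfl (by simpa using hxX a))
  rw [eq_top_iff]
  intro y _
  exact (hB ▸ Algebra.mem_top : y ∈ B)

variable [Fintype Q] [DecidableEq Q]

/-- The coefficient functionals determine an element of the radical up to products of two
arrows. -/
theorem sub_sum_mem_powersFrom {φ : Q → A →ₗ[K] K}
    (hφ : ∀ a b, φ b (x a) = if a = b then 1 else 0)
    (hφ2 : ∀ b, ∀ y ∈ powersFrom (Submodule.span K (Set.range x)) 2, φ b y = 0)
    {y : A} (hy : y ∈ powersFrom (Submodule.span K (Set.range x)) 1) :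
    y - ∑ b, φ b y • x b ∈ powersFrom (Submodule.span K (Set.range x)) 2 := by
  obtain ⟨z, hz, w, hw, rfl⟩ := Submodule.mem_sup.1 (powersFrom_le_sup _ 1 hy)
  rw [pow_one] at hz
  obtain ⟨c, rfl⟩ := (Submodule.mem_span_range_iff_exists_fun K).1 hz
  have : ∀ b, φ b (∑ a, c a • x a + w) = c b := by
    intro b
    simp [hφ, hφ2 b w hw]
  simpa [this] using hw

/-- Solvability criterion: derivations killing the idempotents preserve the radical, and their
linear parts lie in a solvable Lie algebra of matrices. -/
theorem isSolvable_HH1_of_linearPart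
    (hmul : ∀ i j, e i * e j = if i = j then e i else 0)
    (hsum : ∑ i, e i = 1) (hs : ∀ a, e (s a) * x a = x a) (ht : ∀ a, x a * e (t a) = x a)
    (hgen : Algebra.adjoin K (Set.range e ∪ Set.range x) = ⊤)
    {N : ℕ} (hN : powersFrom (Submodule.span K (Set.range x)) N = ⊥)
    {φ : Q → A →ₗ[K] K} (hφ : ∀ a b, φ b (x a) = if a = b then 1 else 0)
    (hφ2 : ∀ b, ∀ y ∈ powersFrom (Submodule.span K (Set.range x)) 2, φ b y = 0)
    (ε : A →ₐ[K] (E → K)) (hεe : ∀ i, ε (e i) = Pi.single i 1) (hεx : ∀ a, ε (x a) = 0)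
    (hrad : ∀ d ∈ algDer K A, (∀ i, d (e i) = 0) → ∀ a, ε (d (x a)) = 0)
    (g : ℕ → Submodule K (Matrix Q Q K)) (r : ℕ)
    (hg0 : ∀ d ∈ algDer K A, (∀ i, d (e i) = 0) → linearPart x φ d ∈ g 0)
    (hg : ∀ n, ∀ m ∈ g n, ∀ m' ∈ g n, m * m' - m' * m ∈ g (n + 1)) (hr : g r = ⊥) :
    LieAlgebra.IsSolvable (HH1 K A) := by
  set X := Submodule.span K (Set.range x) with hXdef
  have htop := span_sup_powersFrom_eq_top hmul hsum hs ht hgen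
  have hxX : ∀ a, x a ∈ X := fun a => Submodule.subset_span ⟨a, rfl⟩
  have hε1 : ∀ y ∈ powersFrom X 1, ε y = 0 := by
    have h0 : X ≤ LinearMap.ker ε.toLinearMap := by
      rw [hXdef, Submodule.span_le]
      rintro _ ⟨a, rfl⟩
      exact hεx a
    have : powersFrom X 1 ≤ LinearMap.ker ε.toLinearMap := by
      refine powersFrom_le fun k hk => ?_
      obtain ⟨k, rfl⟩ := Nat.exists_eq_add_of_le' hk
      rw [pow_succ, Submodule.mul_le]
      intro a _ b hb
      have : ε b = 0 := h0 hb
      simp [this]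
    exact fun y hy => this hy
  -- The filtration step `powersFrom X 1` is exactly the kernel of `ε`.
  have hF1 : ∀ y, ε y = 0 → y ∈ powersFrom X 1 := by
    intro y hy
    obtain ⟨z, hz, w, hw, rfl⟩ := Submodule.mem_sup.1 (htop ▸ Submodule.mem_top :
      y ∈ Submodule.span K (Set.range e) ⊔ powersFrom X 1)
    obtain ⟨c, rfl⟩ := (Submodule.mem_span_range_iff_exists_fun K).1 hz
    have hc : ∀ i, c i = 0 := by
      intro i
      have := congrFun hy i
      simpa [hεe, hε1 w hw, Pi.single_apply] using this
    simpa [hc] using hw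
  -- The chain has two phases. For `n < r` the truncated subtraction makes the exponent 1, and only
  -- the linear part shrinks along `g`. From `n = r` on the linear part is zero, and `d` raises
  -- degrees by `n + 1 - r ≥ 1`; a bracket adds two such shifts and so gains at least one.
  let Q' : ℕ → Submodule K (Module.End K A) := fun n =>
    { carrier := {d | d ∈ algDer K A ∧ (∀ i, d (e i) = 0) ∧ (n ≤ r → linearPart x φ d ∈ g n) ∧
        ∀ a, d (x a) ∈ powersFrom X (n + 1 - r + 1)}
      add_mem' := by
        rintro d d' ⟨h1, h2, h3, h4⟩ ⟨h1', h2', h3', h4'⟩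
        exact ⟨add_mem h1 h1', fun i => by simp [h2, h2'],
          fun h => by rw [map_add]; exact add_mem (h3 h) (h3' h),
          fun a => add_mem (h4 a) (h4' a)⟩
      zero_mem' := ⟨zero_mem _, fun _ => rfl, fun _ => by simp, fun _ => zero_mem _⟩
      smul_mem' := by
        rintro c d ⟨h1, h2, h3, h4⟩
        exact ⟨(algDer K A).smul_mem c h1, fun i => by simp [h2],
          fun h => by rw [map_smul]; exact Submodule.smul_mem _ _ (h3 h),
          fun a => Submodule.smul_mem _ _ (h4 a)⟩ }
  have hred : ∀ n, ∀ d, d ∈ algDer K A → (∀ i, d (e i) = 0) → (n ≤ r → linearPart x φ d ∈ g n) →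
      (∀ a, d (x a) ∈ powersFrom X 1) → (r < n → ∀ a, d (x a) ∈ powersFrom X (n + 1 - r + 1)) →
      d ∈ Q' n := by
    intro n d h1 h2 h3 h4 h5
    refine ⟨h1, h2, h3, fun a => ?_⟩
    rcases lt_trichotomy n r with h | h | h
    · rw [show n + 1 - r + 1 = 1 by omega]
      exact h4 a
    · subst h
      rw [show n + 1 - n + 1 = 2 by omega]
      have h6 := h3 le_rfl
      rw [hr, Submodule.mem_bot] at h6
      have h7 := sub_sum_mem_powersFrom hφ hφ2 (h4 a)
      have h8 : ∀ b, φ b (d (x a)) = 0 := fun b => by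
        rw [← linearPart_apply, h6]; rfl
      simpa [h8] using h7
    · exact h5 h a
  have hdX : ∀ d : Module.End K A, ∀ n, (∀ a, d (x a) ∈ powersFrom X n) →
      ∀ y ∈ X, d y ∈ powersFrom X n := by
    intro d n h y hy
    have : X ≤ (powersFrom X n).comap d := by
      rw [hXdef, Submodule.span_le]
      rintro _ ⟨a, rfl⟩
      exact h a
    exact this hy
  -- Images of arrows are recorded as rows, so composition reverses the order of the matrices. The
  -- term of `d' (x a)` in the square of the radical stays there under `d` and is invisible to `φ
  -- b`.
  have hlin : ∀ d ∈ algDer K A, (∀ a, d (x a) ∈ powersFrom X 1) →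
      ∀ d' : Module.End K A, (∀ a, d' (x a) ∈ powersFrom X 1) →
      linearPart x φ (d * d') = linearPart x φ d' * linearPart x φ d := by
    intro d hd h1 d' h1'
    ext a b
    have h2 := derivation_mem_powersFrom hd (n := 0) (hdX d 1 h1)
      (sub_sum_mem_powersFrom hφ hφ2 (h1' a))
    have h3 := hφ2 b _ h2
    rw [map_sub, map_sub, sub_eq_zero] at h3
    rw [linearPart_apply, Module.End.mul_apply, h3, Matrix.mul_apply]
    simp [linearPart_apply]
  refine isSolvable_HH1_of_chain Q' ?_ ?_ (r + N) ?_
  · intro d hd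
    obtain ⟨a, ha⟩ := exists_sub_inner_apply_eq_zero hmul hsum hd
    have hd' := sub_mem hd (inner_mem_algDer K A a)
    exact ⟨a, hred 0 _ hd' ha (fun _ => hg0 _ hd' ha) (fun b => hF1 _ (hrad _ hd' ha b))
      fun h => absurd h (by omega)⟩
  · rintro n d hd d' hd' ⟨-, h2, h3, h4⟩ ⟨-, h2', h3', h4'⟩
    have h5 : ∀ a, d (x a) ∈ powersFrom X 1 := fun a => powersFrom_antitone X (by omega) (h4 a)
    have h5' : ∀ a, d' (x a) ∈ powersFrom X 1 := fun a => powersFrom_antitone X (by omega) (h4' a)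
    refine hred (n + 1) _ ((algDer K A).lie_mem hd hd') ?_ ?_ ?_ ?_
    · intro i
      simp [h2, h2']
    · intro h
      rw [map_sub, hlin d hd h5 d' h5', hlin d' hd' h5' d h5]
      exact hg n _ (h3' (by omega)) _ (h3 (by omega))
    · intro a
      exact sub_mem (derivation_mem_powersFrom hd (n := 0) (hdX d 1 h5) (h5' a))
        (derivation_mem_powersFrom hd' (n := 0) (hdX d' 1 h5') (h5 a))
    · intro h a
      refine sub_mem (powersFrom_antitone X ?_ (derivation_mem_powersFrom hd (hdX d _ h4) (h4' a)))
        (powersFrom_antitone X ?_ (derivation_mem_powersFrom hd' (hdX d' _ h4') (h4 a))) <;> omega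
  · rw [eq_bot_iff]
    rintro d ⟨h1, h2, -, h4⟩
    have h : ∀ x y, d (x * y) = d x * y + x * d y := h1
    have h5 : ∀ a, d (x a) = 0 := by
      intro a
      have := powersFrom_antitone X (show N ≤ r + N + 1 - r + 1 by omega) (h4 a)
      rwa [hN] at this
    -- The kernel of a derivation is a subalgebra, and this one contains all generators.
    have : (⊤ : Subalgebra K A) ≤
        { LinearMap.ker d with
          mul_mem' := fun {a b} ha hb => by
            have ha : d a = 0 := ha
            have hb : d b = 0 := hb
            change d (a * b) = 0
            simp [h, ha, hb]
          algebraMap_mem' := fun c => by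
            have h1 : d 1 = 0 := by simpa using h 1 1
            change d (algebraMap K A c) = 0
            rw [Algebra.algebraMap_eq_smul_one, map_smul, h1, smul_zero] } := by
      rw [← hgen, Algebra.adjoin_le_iff]
      rintro _ (⟨i, rfl⟩ | ⟨a, rfl⟩)
      · exact h2 i
      · exact h5 a
    rw [Submodule.mem_bot]
    exact LinearMap.ext fun y => this (Algebra.mem_top : y ∈ (⊤ : Subalgebra K A))

end Quiver

end HochschildSolvable

/-! ### Combinatorics of Brauer graphs and the presentation of their algebras. -/

namespace BrauerGraph

variable {V E : Type} (G : BrauerGraph V E)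

theorem flip_flip (h : E × Bool) : flip (flip h) = h := by simp [flip]

theorem flip_ne (h : E × Bool) : flip h ≠ h := fun H => by
  simpa [flip] using congrArg Prod.snd H

theorem flip_fst (h : E × Bool) : (flip h).1 = h.1 := rfl

theorem eq_or_eq_flip_of_fst_eq {h h' : E × Bool} (H : h'.1 = h.1) : h' = h ∨ h' = flip h := by
  obtain ⟨i, b⟩ := h
  obtain ⟨i', b'⟩ := h'
  obtain rfl : i' = i := H
  cases b <;> cases b' <;> simp [flip]

/-- The length `m(v) val(v)` of the maximal powers of special cycles at the vertex of `h`. -/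
noncomputable def len (h : E × Bool) : ℕ := G.val (G.endpoint h) * G.mult (G.endpoint h)

theorem truncated_iff (h : E × Bool) : G.Truncated h ↔ G.len h = 1 := Iff.rfl

section Finite

variable [Finite E]

theorem minimalPeriod_next (h : E × Bool) :
    Function.minimalPeriod G.next h = G.val (G.endpoint h) := by
  classical
  have : Fintype (MulAction.orbit (Subgroup.zpowers G.next) h) := Fintype.ofFinite _
  have h1 := MulAction.minimalPeriod_eq_card (α := Equiv.Perm (E × Bool)) (β := E × Bool)
    (a := G.next) (b := h)
  have h2 : MulAction.orbit (Subgroup.zpowers G.next) h =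
      {h' | G.endpoint h' = G.endpoint h} := by
    ext h'
    rw [Set.mem_ofPred_eq, eq_comm, ← G.sameCycle_iff, MulAction.mem_orbit_iff]
    constructor
    · rintro ⟨⟨_, n, rfl⟩, rfl⟩
      exact ⟨n, rfl⟩
    · rintro ⟨n, rfl⟩
      exact ⟨⟨_, n, rfl⟩, rfl⟩
  refine h1.trans ?_
  rw [← Nat.card_eq_fintype_card, h2]
  rfl

theorem val_pos (h : E × Bool) : 0 < G.val (G.endpoint h) :=
  Nat.card_pos_iff.2 ⟨⟨⟨h, rfl⟩⟩, inferInstance⟩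

theorem len_pos (h : E × Bool) : 0 < G.len h := Nat.mul_pos (G.val_pos h) (G.mult_pos _)

theorem next_eq_of_val_eq_one {h : E × Bool} (H : G.val (G.endpoint h) = 1) : G.next h = h := by
  rw [← minimalPeriod_next, Function.minimalPeriod_eq_one_iff_isFixedPt] at H
  exact H

theorem next_eq_of_len_eq_one {h : E × Bool} (H : G.len h = 1) : G.next h = h :=
  G.next_eq_of_val_eq_one (Nat.eq_one_of_mul_eq_one_right H)

/-- The exceptional clause of `IsArrow` keeps only one half of an edge with two truncated ends, so
an edge carrying two arrows has no truncated half. Hence relations (I) only compare paths of length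
at least two. -/
theorem two_le_len {h : E × Bool} (h1 : G.IsArrow h) (h2 : G.IsArrow (flip h)) : 2 ≤ G.len h := by
  by_contra! H
  have h3 : G.Truncated h := (G.truncated_iff h).2 (by have := G.len_pos h; omega)
  rcases h1 with h1 | ⟨h1, h1'⟩
  · exact h1 h3
  rcases h2 with h2 | ⟨-, h2'⟩
  · exact h2 h1
  · simp [flip, h1'] at h2'

/-- Connectedness in terms of half-edges. -/
theorem half_edge_induction (p : E × Bool → Prop) {h₀ : E × Bool} (h0 : p h₀)
    (hflip : ∀ h, p h → p (flip h)) (hnext : ∀ h, p h → p (G.next h)) (h : E × Bool) : p h := by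
  have hcyc : ∀ h h', p h → G.endpoint h = G.endpoint h' → p h' := by
    intro h h' hp hh
    have hpow : ∀ n : ℕ, p ((G.next ^ n) h) := by
      intro n
      induction n with
      | zero => simpa using hp
      | succ n ih =>
        rw [pow_succ', Equiv.Perm.mul_apply]
        exact hnext _ ih
    obtain ⟨n, -, -, rfl⟩ := ((G.sameCycle_iff h h').2 hh).exists_pow_eq''
    exact hpow n
  have key : ∀ v, (∃ h, p h ∧ G.endpoint h = v) → ∀ w, Relation.ReflTransGen
      (fun a b => ∃ (e : E) (i : Bool), G.endpoint (e, i) = a ∧ G.endpoint (e, !i) = b) v w →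
      ∃ h, p h ∧ G.endpoint h = w := by
    intro v hv w hw
    induction hw with
    | refl => exact hv
    | tail _ hbc ih =>
      obtain ⟨h, hp, hb⟩ := ih
      obtain ⟨e, i, h1, h2⟩ := hbc
      exact ⟨(e, !i), hflip (e, i) (hcyc _ _ hp (hb.trans h1.symm)), h2⟩
  obtain ⟨h', hp, hh⟩ := key _ ⟨h₀, h0, rfl⟩ _ (G.connected _ (G.endpoint h))
  exact hcyc _ _ hp hh

end Finite

namespace Arrow

variable {G}

theorem ext' {a b : G.Arrow} (h : a.1 = b.1) : a = b := Subtype.ext h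

theorem next_val (a : G.Arrow) : (a.next).1 = G.next a.1 := rfl

theorem src_next (a : G.Arrow) : a.next.src = a.tgt := rfl

theorem iterate_next_val (a : G.Arrow) (n : ℕ) : (Arrow.next^[n] a).1 = G.next^[n] a.1 := by
  induction n generalizing a with
  | zero => rfl
  | succ n ih => rw [Function.iterate_succ_apply, Function.iterate_succ_apply, ih, next_val]

theorem next_injective : Function.Injective (Arrow.next (G := G)) := fun _ _ h =>
  ext' (G.next.injective (congrArg Subtype.val h))

noncomputable instance [Finite E] : Fintype G.Arrow :=
  haveI : Finite G.Arrow := Subtype.finite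
  Fintype.ofFinite _

noncomputable instance : DecidableEq G.Arrow := Classical.decEq _

/-- The product of the `n` consecutive arrows around a vertex starting with `a`. -/
def cyc {B : Type*} [Monoid B] (x : G.Arrow → B) (a : G.Arrow) (n : ℕ) : B :=
  ((List.range n).map fun i => x (Arrow.next^[i] a)).prod

variable {B : Type*} [Monoid B] (x : G.Arrow → B) (a : G.Arrow)

theorem cyc_zero : cyc x a 0 = 1 := rfl

theorem cyc_succ (n : ℕ) : cyc x a (n + 1) = cyc x a n * x (Arrow.next^[n] a) := by
  simp [cyc, List.range_succ]

theorem cyc_one : cyc x a 1 = x a := by simp [cyc]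

theorem cyc_add (m n : ℕ) : cyc x a (m + n) = cyc x a m * cyc x (Arrow.next^[m] a) n := by
  induction n with
  | zero => simp [cyc_zero]
  | succ n ih =>
    rw [← add_assoc, cyc_succ, ih, cyc_succ, mul_assoc, ← Function.iterate_add_apply, add_comm n m]

theorem cyc_succ' (n : ℕ) : cyc x a (n + 1) = x a * cyc x a.next n := by
  rw [add_comm, cyc_add, cyc_one]; rfl

theorem cyc_two : cyc x a 2 = x a * x a.next := by rw [cyc_succ', cyc_one]

variable [Finite E]

theorem iterate_next_val_endpoint (a : G.Arrow) :
    Arrow.next^[G.val a.vertex] a = a := by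
  apply ext'
  rw [iterate_next_val, vertex, ← minimalPeriod_next]
  exact Function.iterate_minimalPeriod

theorem iterate_next_mul (a : G.Arrow) (n : ℕ) : Arrow.next^[G.val a.vertex * n] a = a := by
  rw [Function.iterate_mul]
  exact Function.iterate_fixed a.iterate_next_val_endpoint n

theorem iterate_next_len (a : G.Arrow) : Arrow.next^[G.len a.1] a = a := a.iterate_next_mul _

theorem cyc_pow (n : ℕ) : cyc x a (G.val a.vertex) ^ n = cyc x a (G.val a.vertex * n) := by
  induction n with
  | zero => simp [cyc_zero]
  | succ n ih => rw [pow_succ, ih, mul_add_one, cyc_add, iterate_next_mul]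

end Arrow

variable {G} in
theorem eq_flip_of_src_eq {a b : G.Arrow} (hab : a ≠ b) (hs : a.src = b.src) :
    b.1 = flip a.1 :=
  (eq_or_eq_flip_of_fst_eq (hs.symm : b.1.1 = a.1.1)).resolve_left
    fun h => hab (Arrow.ext' h).symm

variable (K : Type*) [Field K] [Fintype E]

/-- The idempotent of an edge in the Brauer graph algebra. -/
noncomputable def idem (i : E) : G.Alg K :=
  RingQuot.mkAlgHom K (G.Rel K) (RingQuot.mkAlgHom K (PathAlgebra.Rel K Arrow.src Arrow.tgt)
    (FreeAlgebra.ι K (Sum.inl i)))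

theorem idem_mul_idem [DecidableEq E] (i j : E) :
    G.idem K i * G.idem K j = if i = j then G.idem K i else 0 := by
  split_ifs with h
  · subst h
    rw [idem, ← map_mul, ← map_mul]
    exact congrArg _ (RingQuot.mkAlgHom_rel K (PathAlgebra.Rel.idem i))
  · rw [idem, idem, ← map_mul, ← map_mul, RingQuot.mkAlgHom_rel K (PathAlgebra.Rel.orth i j h)]
    simp

theorem sum_idem : ∑ i, G.idem K i = 1 := by
  simp only [idem, ← map_sum]
  rw [RingQuot.mkAlgHom_rel K (PathAlgebra.Rel.sum_eq_one (K := K) (src := Arrow.src (G := G))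
    (tgt := Arrow.tgt (G := G)))]
  simp

theorem idem_src_mul (a : G.Arrow) : G.idem K a.src * G.arrow K a = G.arrow K a := by
  rw [idem, arrow, PathAlgebra.arrow, ← map_mul, ← map_mul]
  exact congrArg _ (RingQuot.mkAlgHom_rel K (PathAlgebra.Rel.src_mul a))

theorem mul_idem_tgt (a : G.Arrow) : G.arrow K a * G.idem K a.tgt = G.arrow K a := by
  rw [idem, arrow, PathAlgebra.arrow, ← map_mul, ← map_mul]
  exact congrArg _ (RingQuot.mkAlgHom_rel K (PathAlgebra.Rel.mul_tgt a))

theorem mkAlgHom_specialCycle (a : G.Arrow) :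
    RingQuot.mkAlgHom K (G.Rel K) (G.specialCycle K a ^ G.mult a.vertex) =
      Arrow.cyc (G.arrow K) a (G.len a.1) := by
  rw [map_pow, specialCycle, map_list_prod, List.map_map]
  exact Arrow.cyc_pow (G.arrow K) a _

theorem cyc_eq_cyc (a b : G.Arrow) (hab : b.1 = flip a.1) :
    Arrow.cyc (G.arrow K) a (G.len a.1) = Arrow.cyc (G.arrow K) b (G.len b.1) := by
  rw [← mkAlgHom_specialCycle, ← mkAlgHom_specialCycle]
  exact RingQuot.mkAlgHom_rel K (Rel.cycle a b hab)

theorem cyc_mul_arrow (a : G.Arrow) (ha : ¬ G.IsArrow (flip a.1)) :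
    Arrow.cyc (G.arrow K) a (G.len a.1) * G.arrow K a = 0 := by
  rw [← mkAlgHom_specialCycle, arrow, ← map_mul, RingQuot.mkAlgHom_rel K (Rel.overlong a ha),
    map_zero]

theorem arrow_mul_turn (a b : G.Arrow) (hab : b.1 = flip (G.next a.1)) :
    G.arrow K a * G.arrow K b = 0 := by
  rw [arrow, arrow, ← map_mul, RingQuot.mkAlgHom_rel K (Rel.turn a b hab), map_zero]

theorem adjoin_eq_top :
    Algebra.adjoin K (Set.range (G.idem K) ∪ Set.range (G.arrow K)) = ⊤ := by
  let f : FreeAlgebra K (E ⊕ G.Arrow) →ₐ[K] G.Alg K := (RingQuot.mkAlgHom K (G.Rel K)).comp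
    (RingQuot.mkAlgHom K (PathAlgebra.Rel K Arrow.src Arrow.tgt))
  have hf : Function.Surjective f :=
    (RingQuot.mkAlgHom_surjective K _).comp (RingQuot.mkAlgHom_surjective K _)
  have h1 : Set.range (G.idem K) ∪ Set.range (G.arrow K) = f '' Set.range (FreeAlgebra.ι K) := by
    rw [← Set.range_comp, ← Set.Sum.elim_range]
    congr 1
    ext (i | a) <;> rfl
  rw [h1, ← AlgHom.map_adjoin, FreeAlgebra.adjoin_range_ι, Algebra.map_top,
    (AlgHom.range_eq_top f).2 hf]

theorem idem_mul_arrow [DecidableEq E] (i : E) (a : G.Arrow) :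
    G.idem K i * G.arrow K a = if i = a.src then G.arrow K a else 0 := by
  rw [← G.idem_src_mul K a, ← mul_assoc, idem_mul_idem]
  split_ifs with h <;> simp [h]

theorem arrow_mul_idem [DecidableEq E] (a : G.Arrow) (i : E) :
    G.arrow K a * G.idem K i = if a.tgt = i then G.arrow K a else 0 := by
  rw [← G.mul_idem_tgt K a, mul_assoc, idem_mul_idem]
  split_ifs with h <;> simp

section Lift

variable {G K}
variable {B : Type*} [Ring B] [Algebra K B] [DecidableEq E]

/-- Algebra homomorphisms from a Brauer graph algebra by generators and relations. -/
noncomputable def lift (e : E → B) (x : G.Arrow → B)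
    (hmul : ∀ i j, e i * e j = if i = j then e i else 0) (hsum : ∑ i, e i = 1)
    (hs : ∀ a, e a.src * x a = x a) (ht : ∀ a, x a * e a.tgt = x a)
    (hcyc : ∀ a b, b.1 = flip a.1 → Arrow.cyc x a (G.len a.1) = Arrow.cyc x b (G.len b.1))
    (hover : ∀ a, ¬ G.IsArrow (flip a.1) → Arrow.cyc x a (G.len a.1) * x a = 0)
    (hturn : ∀ a b, b.1 = flip (G.next a.1) → x a * x b = 0) : G.Alg K →ₐ[K] B :=
  let f : G.KQ K →ₐ[K] B := RingQuot.liftAlgHom K ⟨FreeAlgebra.lift K (Sum.elim e x), by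
    rintro _ _ (i | ⟨i, j, hij⟩ | _ | a | a)
    · simp [hmul]
    · simp [hmul, hij]
    · simp [hsum]
    · simp [hs]
    · simp [ht]⟩
  have hf : ∀ a, f (PathAlgebra.arrow K Arrow.src Arrow.tgt a) = x a := fun a => by
    simp only [f, PathAlgebra.arrow, RingQuot.liftAlgHom_mkAlgHom_apply]
    simp
  have hC : ∀ a, f (G.specialCycle K a ^ G.mult a.vertex) = Arrow.cyc x a (G.len a.1) :=
    fun a => by
      rw [map_pow, specialCycle, map_list_prod, List.map_map, len]
      simp only [Function.comp_def, hf]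
      exact Arrow.cyc_pow x a _
  RingQuot.liftAlgHom K ⟨f, by
    rintro _ _ (⟨a, b, hab⟩ | ⟨a, ha⟩ | ⟨a, b, hab⟩)
    · rw [hC, hC, hcyc a b hab]
    · rw [map_mul, hC, hf, hover a ha, map_zero]
    · rw [map_mul, hf, hf, hturn a b hab, map_zero]⟩

variable {e : E → B} {x : G.Arrow → B}
    (hmul : ∀ i j, e i * e j = if i = j then e i else 0) (hsum : ∑ i, e i = 1)
    (hs : ∀ a, e a.src * x a = x a) (ht : ∀ a, x a * e a.tgt = x a)
    (hcyc : ∀ a b, b.1 = flip a.1 → Arrow.cyc x a (G.len a.1) = Arrow.cyc x b (G.len b.1))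
    (hover : ∀ a, ¬ G.IsArrow (flip a.1) → Arrow.cyc x a (G.len a.1) * x a = 0)
    (hturn : ∀ a b, b.1 = flip (G.next a.1) → x a * x b = 0)

theorem lift_idem (i : E) :
    lift (K := K) e x hmul hsum hs ht hcyc hover hturn (G.idem K i) = e i := by
  simp only [lift, idem, RingQuot.liftAlgHom_mkAlgHom_apply]
  simp

theorem lift_arrow (a : G.Arrow) :
    lift (K := K) e x hmul hsum hs ht hcyc hover hturn (G.arrow K a) = x a := by
  simp only [lift, arrow, PathAlgebra.arrow, RingQuot.liftAlgHom_mkAlgHom_apply]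
  simp

end Lift

theorem algHom_ext {B : Type*} [Ring B] [Algebra K B] {f g : G.Alg K →ₐ[K] B}
    (h1 : ∀ i, f (G.idem K i) = g (G.idem K i)) (h2 : ∀ a, f (G.arrow K a) = g (G.arrow K a)) :
    f = g :=
  AlgHom.ext_of_adjoin_eq_top (G.adjoin_eq_top K) (by
    rintro _ (⟨i, rfl⟩ | ⟨a, rfl⟩)
    · exact h1 i
    · exact h2 a)

/-- Either the endpoints do not match and orthogonal idempotents kill the product, or `b` starts at
the half-edge opposite to the successor of `a`, which is relation (III). -/
theorem arrow_mul_arrow_of_ne {a b : G.Arrow} (h : b ≠ a.next) :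
    G.arrow K a * G.arrow K b = 0 := by
  classical
  by_cases hab : b.src = a.tgt
  · rcases eq_or_eq_flip_of_fst_eq (hab : b.1.1 = (G.next a.1).1) with h1 | h1
    · exact absurd (Arrow.ext' h1) h
    · exact G.arrow_mul_turn K a b h1
  · rw [← G.mul_idem_tgt K a, ← G.idem_src_mul K b, mul_assoc, ← mul_assoc (G.idem K _),
      idem_mul_idem, if_neg (Ne.symm hab)]
    simp

/-- One arrow beyond a maximal path already gives zero. If the edge has a second arrow `b`, relation
(I) replaces the maximal path at `a` by the one at `b`; its last arrow must be followed by `b`, not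
by `a`. Otherwise this is relation (II). -/
theorem cyc_eq_zero {a : G.Arrow} {n : ℕ} (hn : G.len a.1 < n) :
    Arrow.cyc (G.arrow K) a n = 0 := by
  have h1 : Arrow.cyc (G.arrow K) a (G.len a.1 + 1) = 0 := by
    rw [Arrow.cyc_succ, Arrow.iterate_next_len]
    by_cases h : G.IsArrow (flip a.1)
    · let b : G.Arrow := ⟨flip a.1, h⟩
      rw [G.cyc_eq_cyc K a b rfl]
      obtain ⟨k, hk⟩ := Nat.exists_eq_succ_of_ne_zero (G.len_pos b.1).ne'
      rw [hk, Arrow.cyc_succ, mul_assoc, arrow_mul_arrow_of_ne, mul_zero]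
      rw [← Function.iterate_succ_apply' Arrow.next, ← hk, Arrow.iterate_next_len]
      intro H
      exact flip_ne a.1 (congrArg Subtype.val H).symm
    · exact G.cyc_mul_arrow K a h
  obtain ⟨k, rfl⟩ := Nat.exists_eq_add_of_le hn
  rw [Arrow.cyc_add, h1, zero_mul]

/-- The span of the arrows. -/
noncomputable def arrows : Submodule K (G.Alg K) := Submodule.span K (Set.range (G.arrow K))

/-- A product of arrows survives only if every factor is the successor of the previous one. -/
theorem arrows_pow_le (n : ℕ) :
    G.arrows K ^ (n + 1) ≤
      Submodule.span K (Set.range fun a => Arrow.cyc (G.arrow K) a (n + 1)) := by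
  induction n with
  | zero => simp [arrows, Arrow.cyc_one]
  | succ n ih =>
    rw [pow_succ']
    refine (mul_le_mul' le_rfl ih).trans ?_
    rw [arrows, Submodule.span_mul_span, Submodule.span_le]
    rintro _ ⟨_, ⟨a, rfl⟩, _, ⟨b, rfl⟩, rfl⟩
    by_cases h : b = a.next
    · subst h
      exact Submodule.subset_span ⟨a, Arrow.cyc_succ' _ _ _⟩
    · simp [Arrow.cyc_succ', ← mul_assoc, G.arrow_mul_arrow_of_ne K h]

theorem exists_powersFrom_arrows_eq_bot : ∃ N, powersFrom (K := K) (A := G.Alg K) (G.arrows K) N = ⊥ := by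
  refine ⟨Finset.univ.sup (fun a : G.Arrow => G.len a.1) + 1, ?_⟩
  rw [eq_bot_iff]
  refine powersFrom_le fun k hk => ?_
  obtain ⟨k, rfl⟩ : ∃ n, k = n + 1 := ⟨k - 1, by omega⟩
  refine (G.arrows_pow_le K k).trans ?_
  rw [Submodule.span_le]
  rintro _ ⟨a, rfl⟩
  refine G.cyc_eq_zero K (lt_of_le_of_lt ?_ (Nat.lt_of_succ_le hk))
  exact Finset.le_sup (f := fun a : G.Arrow => G.len a.1) (Finset.mem_univ a)

end BrauerGraph

/-! ### The augmentation and the serial representations. -/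

namespace BrauerGraph

variable {V E : Type} (G : BrauerGraph V E)

theorem cyc_eq_zero_of_mul {B : Type*} [Ring B] {x : G.Arrow → B} (h : ∀ a b, x a * x b = 0)
    (a : G.Arrow) {n : ℕ} (hn : 2 ≤ n) : Arrow.cyc x a n = 0 := by
  obtain ⟨k, rfl⟩ := Nat.exists_eq_add_of_le' hn
  rw [Arrow.cyc_succ', Arrow.cyc_succ', ← mul_assoc, h, zero_mul]

section SerialArrow

variable {G} (K : Type*) [Field K] (b : G.Arrow)

open Classical in
/-- The matrix of the arrow `a` in the serial representation at `b`. -/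
noncomputable def serialArrow (a : G.Arrow) : Matrix (Fin 3) (Fin 3) K :=
  -- The second step is omitted when `b` has length at most two: a path `b b.next` that is maximal
  -- would have to agree with the maximal path of the opposite arrow, which acts by zero here.
  !![0, if a = b then 1 else 0, 0; 0, 0, if a = b.next ∧ 3 ≤ G.len b.1 then 1 else 0; 0, 0, 0]

open Classical in
theorem serialArrow_mul (a c : G.Arrow) : serialArrow K b a * serialArrow K b c =
    !![0, 0, if a = b ∧ c = b.next ∧ 3 ≤ G.len b.1 then 1 else 0; 0, 0, 0; 0, 0, 0] := by
  ext i j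
  fin_cases i <;> fin_cases j <;> simp [serialArrow, Matrix.mul_apply, Fin.sum_univ_three]
  split_ifs <;> simp_all

open Classical in
theorem serialArrow_mul_mul (a c d : G.Arrow) :
    serialArrow K b a * (serialArrow K b c * serialArrow K b d) = 0 := by
  rw [serialArrow_mul]
  ext i j
  fin_cases i <;> fin_cases j <;> simp [serialArrow, Matrix.mul_apply, Fin.sum_univ_three]

theorem serialArrow_cyc {a : G.Arrow} (h : 2 ≤ G.len a.1) :
    Arrow.cyc (serialArrow K b) a (G.len a.1) = 0 := by
  obtain ⟨k, hk⟩ := Nat.exists_eq_add_of_le' h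
  rw [hk, Arrow.cyc_succ', Arrow.cyc_succ']
  cases k with
  | zero =>
    rw [Arrow.cyc_zero, mul_one, serialArrow_mul, if_neg]
    · ext i j
      fin_cases i <;> fin_cases j <;> rfl
    · rintro ⟨rfl, -, h3⟩
      omega
  | succ k =>
    rw [Arrow.cyc_succ', ← mul_assoc, ← mul_assoc, mul_assoc (serialArrow K b a),
      serialArrow_mul_mul, zero_mul]

end SerialArrow

variable (K : Type*) [Field K] [Fintype E] [DecidableEq E]

/-- The augmentation of a Brauer graph algebra, with kernel the ideal generated by the arrows. -/
noncomputable def augmentation : G.Alg K →ₐ[K] (E → K) :=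
  lift (fun i => Pi.single i 1) 0
    (fun i j => by
      split_ifs with h
      · subst h
        simp [← Pi.single_mul]
      · ext k
        by_cases hk : k = i
        · subst hk
          simp [h]
        · simp [hk])
    (Finset.univ_sum_single (1 : E → K))
    (by simp) (by simp)
    (fun a b h => by
      rw [cyc_eq_zero_of_mul G (by simp) a (G.two_le_len a.2 (h ▸ b.2)),
        cyc_eq_zero_of_mul G (by simp) b (G.two_le_len b.2 (by rw [h, flip_flip]; exact a.2))])
    (by simp) (by simp)

theorem augmentation_idem (i : E) : G.augmentation K (G.idem K i) = Pi.single i 1 :=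
  lift_idem ..

theorem augmentation_arrow (a : G.Arrow) : G.augmentation K (G.arrow K a) = 0 :=
  lift_arrow ..

section Serial

variable {G}
variable (b : G.Arrow)

/-- The matrix of an idempotent in the serial representation at `b`. -/
noncomputable def serialIdem (i : E) : Matrix (Fin 3) (Fin 3) K :=
  Matrix.diagonal fun k => if i = ![b.src, b.tgt, b.next.tgt] k then 1 else 0

/-- The serial representation with the arrow `b`, followed by `b.next` if the path `b b.next` is
not a maximal one. -/
noncomputable def serialRep : G.Alg K →ₐ[K] Matrix (Fin 3) (Fin 3) K :=
  lift (serialIdem K b) (serialArrow K b)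
    (fun i j => by
      rw [serialIdem, serialIdem, Matrix.diagonal_mul_diagonal]
      split_ifs with h
      · subst h
        congr 1
        ext k
        split_ifs <;> simp
      · rw [← Matrix.diagonal_zero]
        congr 1
        ext k
        split_ifs with h1 h2 <;> simp
        exact h (h1.trans h2.symm))
    (by
      ext i j
      rw [Matrix.sum_apply]
      by_cases h : i = j
      · subst h
        simp [serialIdem]
      · simp [serialIdem, h])
    (fun a => by
      ext i j
      rw [serialIdem, Matrix.diagonal_mul]
      fin_cases i <;> fin_cases j <;> simp [serialArrow] <;> split_ifs <;> simp_all [Arrow.src_next])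
    (fun a => by
      ext i j
      rw [serialIdem, Matrix.mul_diagonal]
      fin_cases i <;> fin_cases j <;> simp [serialArrow] <;> split_ifs <;> simp_all)
    (fun a c h => by
      rw [serialArrow_cyc K b (G.two_le_len a.2 (h ▸ c.2)),
        serialArrow_cyc K b (G.two_le_len c.2 (by rw [h, flip_flip]; exact a.2))])
    (fun a _ => by
      by_cases h : 2 ≤ G.len a.1
      · rw [serialArrow_cyc K b h, zero_mul]
      · have := G.len_pos a.1
        obtain h1 : G.len a.1 = 1 := by omega
        rw [h1, Arrow.cyc_one, serialArrow_mul, if_neg]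
        · ext i j
          fin_cases i <;> fin_cases j <;> rfl
        · rintro ⟨rfl, -, h3⟩
          omega)
    (fun a c h => by
      rw [serialArrow_mul, if_neg]
      · ext i j
        fin_cases i <;> fin_cases j <;> rfl
      · rintro ⟨rfl, rfl, -⟩
        exact flip_ne _ h.symm)

theorem serialRep_idem (i : E) : serialRep K b (G.idem K i) = serialIdem K b i := lift_idem ..

theorem serialRep_arrow (a : G.Arrow) : serialRep K b (G.arrow K a) = serialArrow K b a :=
  lift_arrow ..

end Serial

end BrauerGraph

/-! ### Coefficients of arrows and the constraints on derivations. -/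

namespace BrauerGraph

variable {V E : Type} {G : BrauerGraph V E} {K : Type*} [Field K] [Fintype E]

theorem idem_src_mul_derivation {d : Module.End K (G.Alg K)}
    (hd : d ∈ algDer K (G.Alg K)) (he : ∀ i, d (G.idem K i) = 0) (a : G.Arrow) :
    G.idem K a.src * d (G.arrow K a) = d (G.arrow K a) := by
  have h := hd (G.idem K a.src) (G.arrow K a)
  rw [idem_src_mul, he, zero_mul, zero_add] at h
  exact h.symm

theorem derivation_mul_idem_tgt {d : Module.End K (G.Alg K)}
    (hd : d ∈ algDer K (G.Alg K)) (he : ∀ i, d (G.idem K i) = 0) (a : G.Arrow) :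
    d (G.arrow K a) * G.idem K a.tgt = d (G.arrow K a) := by
  have h := hd (G.arrow K a) (G.idem K a.tgt)
  rw [mul_idem_tgt, he, mul_zero, add_zero] at h
  exact h.symm

variable [DecidableEq E]

section Coeff

variable (b : G.Arrow)

/-- Triangularity with diagonal given by the augmentation makes the entry `(0, 1)` a twisted
derivation (`coeff_mul`), and hence a functional vanishing on products of two radical elements. -/
theorem serialRep_triangular (y : G.Alg K) :
    serialRep K b y 1 0 = 0 ∧ serialRep K b y 2 0 = 0 ∧ serialRep K b y 2 1 = 0 ∧
    serialRep K b y 0 0 = G.augmentation K y b.src ∧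
    serialRep K b y 1 1 = G.augmentation K y b.tgt ∧
    serialRep K b y 2 2 = G.augmentation K y b.next.tgt := by
  have hy : y ∈ Algebra.adjoin K (Set.range (G.idem K) ∪ Set.range (G.arrow K)) := by
    rw [adjoin_eq_top]
    exact Algebra.mem_top
  induction hy using Algebra.adjoin_induction with
  | mem z hz =>
    rcases hz with ⟨i, rfl⟩ | ⟨a, rfl⟩
    · simp [serialRep_idem, augmentation_idem, serialIdem, Pi.single_apply, eq_comm]
      refine ⟨?_, ?_, ?_⟩ <;> congr
    · simp [serialRep_arrow, augmentation_arrow, serialArrow]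
  | algebraMap c => simp [Matrix.algebraMap_matrix_apply]
  | add z w _ _ hz hw =>
    obtain ⟨h1, h2, h3, h4, h5, h6⟩ := hz
    obtain ⟨k1, k2, k3, k4, k5, k6⟩ := hw
    simp [h1, h2, h3, h4, h5, h6, k1, k2, k3, k4, k5, k6]
  | mul z w _ _ hz hw =>
    obtain ⟨h1, h2, h3, h4, h5, h6⟩ := hz
    obtain ⟨k1, k2, k3, k4, k5, k6⟩ := hw
    simp [Matrix.mul_apply, Fin.sum_univ_three, h1, h2, h3, h4, h5, h6, k1, k2, k3, k4, k5, k6]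

/-- The coefficient of the arrow `b`. -/
noncomputable def coeff : G.Alg K →ₗ[K] K :=
  (Matrix.entryLinearMap K K 0 1).comp (serialRep K b).toLinearMap

theorem coeff_apply (y : G.Alg K) : coeff b y = serialRep K b y 0 1 := rfl

theorem coeff_arrow (a : G.Arrow) : coeff b (G.arrow K a) = if a = b then 1 else 0 := by
  rw [coeff_apply, serialRep_arrow]
  simp [serialArrow]

theorem coeff_idem (i : E) : coeff b (G.idem K i) = 0 := by
  rw [coeff_apply, serialRep_idem]
  simp [serialIdem]

theorem coeff_mul (y z : G.Alg K) : coeff b (y * z) =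
    G.augmentation K y b.src * coeff b z + coeff b y * G.augmentation K z b.tgt := by
  obtain ⟨-, -, -, h4, -, -⟩ := serialRep_triangular b y
  obtain ⟨-, -, h3, -, h5, -⟩ := serialRep_triangular b z
  simp [coeff_apply, Matrix.mul_apply, Fin.sum_univ_three, h3, h4, h5]

theorem augmentation_eq_zero_of_mem_arrows {y : G.Alg K} (hy : y ∈ G.arrows K) :
    G.augmentation K y = 0 := by
  have : G.arrows K ≤ LinearMap.ker (G.augmentation K).toLinearMap := by
    rw [arrows, Submodule.span_le]
    rintro _ ⟨a, rfl⟩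
    exact G.augmentation_arrow K a
  exact this hy

theorem coeff_eq_zero_of_mem_powersFrom {y : G.Alg K}
    (hy : y ∈ powersFrom (K := K) (A := G.Alg K) (G.arrows K) 2) : coeff b y = 0 := by
  have h : powersFrom (K := K) (A := G.Alg K) (G.arrows K) 2 ≤ LinearMap.ker (coeff b) := by
    refine powersFrom_le fun k hk => ?_
    obtain ⟨k, rfl⟩ := Nat.exists_eq_add_of_le' hk
    rw [pow_succ', pow_succ, Submodule.mul_le]
    intro z hz w hw
    have hw' : G.augmentation K w = 0 := by
      have : G.arrows K ^ k * G.arrows K ≤ LinearMap.ker (G.augmentation K).toLinearMap := by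
        rw [Submodule.mul_le]
        intro p _ q hq
        have hq := augmentation_eq_zero_of_mem_arrows hq
        simp [hq]
      exact this hw
    simp [coeff_mul, hw', augmentation_eq_zero_of_mem_arrows hz]
  exact h hy

end Coeff

theorem augmentation_derivation_of_src_ne {d : Module.End K (G.Alg K)}
    (hd : d ∈ algDer K (G.Alg K)) (he : ∀ i, d (G.idem K i) = 0) {a : G.Arrow} {i : E} (h : i ≠ a.src) :
    G.augmentation K (d (G.arrow K a)) i = 0 := by
  rw [← idem_src_mul_derivation hd he, map_mul, augmentation_idem]
  simp [h]

theorem augmentation_derivation_of_tgt_ne {d : Module.End K (G.Alg K)}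
    (hd : d ∈ algDer K (G.Alg K)) (he : ∀ i, d (G.idem K i) = 0) {a : G.Arrow} {i : E} (h : i ≠ a.tgt) :
    G.augmentation K (d (G.arrow K a)) i = 0 := by
  rw [← derivation_mul_idem_tgt hd he, map_mul, augmentation_idem]
  simp [h]

theorem coeff_derivation_of_src_ne {d : Module.End K (G.Alg K)}
    (hd : d ∈ algDer K (G.Alg K)) (he : ∀ i, d (G.idem K i) = 0) {a b : G.Arrow} (h : b.src ≠ a.src) :
    coeff b (d (G.arrow K a)) = 0 := by
  rw [← idem_src_mul_derivation hd he, coeff_mul, augmentation_idem]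
  simp [h, coeff_idem]

theorem coeff_derivation_of_tgt_ne {d : Module.End K (G.Alg K)}
    (hd : d ∈ algDer K (G.Alg K)) (he : ∀ i, d (G.idem K i) = 0) {a b : G.Arrow} (h : b.tgt ≠ a.tgt) :
    coeff b (d (G.arrow K a)) = 0 := by
  rw [← derivation_mul_idem_tgt hd he, coeff_mul, augmentation_idem]
  simp [h, coeff_idem]

theorem derivation_mul_of_mul_eq_zero {A : Type*} [Ring A] [Algebra K A]
    {d : Module.End K A} (hd : d ∈ algDer K A) {y z : A} (h : y * z = 0) :
    d y * z + y * d z = 0 := by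
  have := hd y z
  rw [h, map_zero] at this
  exact this.symm

/-- A loop with square zero. -/
theorem two_mul_augmentation_derivation {d : Module.End K (G.Alg K)}
    (hd : d ∈ algDer K (G.Alg K)) {a : G.Arrow} (h : G.next a.1 = flip a.1) :
    2 * G.augmentation K (d (G.arrow K a)) a.src = 0 := by
  have h1 : G.arrow K a * G.arrow K a = 0 := arrow_mul_turn G K a a (by rw [h, flip_flip])
  -- Modulo products of two arrows, differentiating `a² = 0` leaves twice the constant term of `d a`
  -- times `a`.
  have h2 := congrArg (coeff a) (derivation_mul_of_mul_eq_zero hd h1)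
  have h3 : a.tgt = a.src := by rw [Arrow.tgt, h]; rfl
  simpa [coeff_mul, coeff_arrow, augmentation_arrow, h3, two_mul] using h2

/-- A loop at an edge with another arrow. -/
theorem augmentation_derivation_of_next_eq {d : Module.End K (G.Alg K)}
    (hd : d ∈ algDer K (G.Alg K)) {a : G.Arrow} (h : G.next a.1 = a.1)
    (h' : G.IsArrow (flip a.1)) :
    G.augmentation K (d (G.arrow K a)) a.src = 0 := by
  let b : G.Arrow := ⟨flip a.1, h'⟩
  have hab : a ≠ b := fun H => flip_ne a.1 (congrArg Subtype.val H).symm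
  have h1 : G.arrow K a * G.arrow K b = 0 := arrow_mul_turn G K a b (by rw [h])
  -- In `d a * b + a * d b = 0` the arrow `b` appears only with the constant term of `d a`, since `a
  -- ≠ b`.
  have h2 := congrArg (coeff b) (derivation_mul_of_mul_eq_zero hd h1)
  have h3 : b.src = a.src := rfl
  simpa [coeff_mul, coeff_arrow, augmentation_arrow, h3, hab] using h2

/-- Coefficients of a parallel arrow which is not half of a maximal path. -/
theorem coeff_derivation_of_three_le {d : Module.End K (G.Alg K)}
    (hd : d ∈ algDer K (G.Alg K)) (he : ∀ i, d (G.idem K i) = 0) {a b : G.Arrow} (hab : a ≠ b)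
    (hb : 3 ≤ G.len b.1) : coeff b (d (G.arrow K a)) = 0 := by
  by_cases hs : b.src = a.src
  swap
  · exact coeff_derivation_of_src_ne hd he hs
  by_cases ht : b.tgt = a.tgt
  swap
  · exact coeff_derivation_of_tgt_ne hd he ht
  have h1 : G.arrow K a * G.arrow K b.next = 0 :=
    G.arrow_mul_arrow_of_ne K fun h => hab (Arrow.next_injective h).symm
  -- The entry `(0, 2)` reads off the coefficient of the path `b b.next`. It is the coefficient of
  -- `b` in `d a`: the other summand starts with `a ≠ b`, whose first row is zero.
  have h2 := congrFun (congrFun (congrArg (serialRep K b)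
    (derivation_mul_of_mul_eq_zero hd h1)) 0) 2
  rw [coeff_apply]
  simpa [Matrix.mul_apply, Fin.sum_univ_three, serialRep_arrow, serialArrow, hab, hb,
    Matrix.vecMul, dotProduct] using h2

/-- Only loops need a hypothesis on constant terms: `d a` is fixed by the idempotents at the source
and target of `a`, so its augmentation vanishes if these differ. -/
theorem isSolvable_of_linearPart
    (hrad : ∀ d ∈ algDer K (G.Alg K), (∀ i, d (G.idem K i) = 0) → ∀ a : G.Arrow, a.src = a.tgt →
      G.augmentation K (d (G.arrow K a)) a.src = 0)
    (g : ℕ → Submodule K (Matrix G.Arrow G.Arrow K)) (r : ℕ)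
    (hg0 : ∀ d ∈ algDer K (G.Alg K), (∀ i, d (G.idem K i) = 0) →
      linearPart (G.arrow K) coeff d ∈ g 0)
    (hg : ∀ n, ∀ m ∈ g n, ∀ m' ∈ g n, m * m' - m' * m ∈ g (n + 1)) (hr : g r = ⊥) :
    LieAlgebra.IsSolvable (HH1 K (G.Alg K)) := by
  obtain ⟨N, hN⟩ := G.exists_powersFrom_arrows_eq_bot K
  refine isSolvable_HH1_of_linearPart (G.idem_mul_idem K) (G.sum_idem K) (G.idem_src_mul K)
    (G.mul_idem_tgt K) (G.adjoin_eq_top K) hN (φ := coeff) (fun a b => coeff_arrow b a)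
    (fun b y hy => coeff_eq_zero_of_mem_powersFrom b hy) (G.augmentation K)
    (G.augmentation_idem K) (G.augmentation_arrow K) ?_ g r hg0 hg hr
  intro d hd he a
  ext i
  by_cases hs : i = a.src
  swap
  · exact augmentation_derivation_of_src_ne hd he hs
  by_cases ht : i = a.tgt
  swap
  · exact augmentation_derivation_of_tgt_ne hd he ht
  rw [hs]
  exact hrad d hd he a (hs.symm.trans ht)

/-- Triangular linear parts. -/
theorem isSolvable_of_triangular
    (hrad : ∀ d ∈ algDer K (G.Alg K), (∀ i, d (G.idem K i) = 0) → ∀ a : G.Arrow, a.src = a.tgt →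
      G.augmentation K (d (G.arrow K a)) a.src = 0)
    (R : G.Arrow → G.Arrow → Prop) (hR : ∀ a b c, R a b → ¬ R b c)
    (hg0 : ∀ d ∈ algDer K (G.Alg K), (∀ i, d (G.idem K i) = 0) → ∀ a b, a ≠ b → ¬ R a b →
      coeff b (d (G.arrow K a)) = 0) :
    LieAlgebra.IsSolvable (HH1 K (G.Alg K)) := by
  -- Level 0 allows the diagonal and the positions in `R`, level 1 requires a zero diagonal, and
  -- level 2 is zero.
  let g : ℕ → Submodule K (Matrix G.Arrow G.Arrow K) := fun n =>
    { carrier := {m | (∀ a b, a ≠ b → (¬ R a b ∨ 2 ≤ n) → m a b = 0) ∧ (1 ≤ n → ∀ a, m a a = 0)}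
      add_mem' := by
        rintro m m' ⟨h1, h2⟩ ⟨h1', h2'⟩
        exact ⟨fun a b h h' => by simp [h1 a b h h', h1' a b h h'],
          fun h a => by simp [h2 h a, h2' h a]⟩
      zero_mem' := ⟨fun _ _ _ _ => rfl, fun _ _ => rfl⟩
      smul_mem' := by
        rintro c m ⟨h1, h2⟩
        exact ⟨fun a b h h' => by simp [h1 a b h h'], fun h a => by simp [h2 h a]⟩ }
  -- Since `R` has no two composable pairs, a product of two off-diagonal entries vanishes. What
  -- remains is a diagonal entry times an entry in `R`, or a product of diagonal entries, which
  -- cancels in the commutator.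
  have hmul : ∀ n, ∀ m ∈ g n, ∀ m' ∈ g n, ∀ a c b, ¬ (c = a ∧ c = b) →
      (¬ R a b ∨ a = b ∨ 1 ≤ n) → m a c * m' c b = 0 := by
    rintro n m ⟨h1, h2⟩ m' ⟨h1', h2'⟩ a c b h h'
    by_cases hac : a = c
    · subst hac
      have hab : a ≠ b := fun H => h ⟨rfl, H⟩
      rcases h' with h' | h' | h'
      · rw [h1' a b hab (Or.inl h'), mul_zero]
      · exact absurd h' hab
      · rw [h2 h', zero_mul]
    by_cases hcb : c = b
    · subst hcb
      rcases h' with h' | h' | h'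
      · rw [h1 a c hac (Or.inl h'), zero_mul]
      · exact absurd h' hac
      · rw [h2' h', mul_zero]
    by_cases hR1 : R a c
    · rw [h1' c b hcb (Or.inl (hR _ _ _ hR1)), mul_zero]
    · rw [h1 a c hac (Or.inl hR1), zero_mul]
  refine isSolvable_of_linearPart hrad g 2 ?_ ?_ ?_
  · intro d hd he
    exact ⟨fun a b hab h => hg0 d hd he a b hab (h.resolve_right (by omega)),
      fun h => absurd h (by omega)⟩
  · intro n m hm m' hm'
    constructor
    · intro a b hab h
      have h' : ¬ R a b ∨ a = b ∨ 1 ≤ n := by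
        rcases h with h | h
        · exact Or.inl h
        · exact Or.inr (Or.inr (by omega))
      rw [Matrix.sub_apply, Matrix.mul_apply, Matrix.mul_apply,
        Finset.sum_eq_zero fun c _ => hmul n m hm m' hm' a c b
          (fun H => hab (H.1.symm.trans H.2)) h',
        Finset.sum_eq_zero fun c _ => hmul n m' hm' m hm a c b
          (fun H => hab (H.1.symm.trans H.2)) h', sub_zero]
    · intro _ a
      rw [Matrix.sub_apply, Matrix.mul_apply, Matrix.mul_apply,
        Finset.sum_eq_single a (fun c _ hc => hmul n m hm m' hm' a c a (fun H => hc H.1)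
          (Or.inr (Or.inl rfl))) (by simp),
        Finset.sum_eq_single a (fun c _ hc => hmul n m' hm' m hm a c a (fun H => hc H.1)
          (Or.inr (Or.inl rfl))) (by simp), mul_comm, sub_self]
  · rw [eq_bot_iff]
    rintro m ⟨h1, h2⟩
    rw [Submodule.mem_bot]
    ext a b
    by_cases hab : a = b
    · subst hab
      exact h2 (by omega) a
    · exact h1 a b hab (Or.inr le_rfl)

end BrauerGraph

/-! ### Solvable Lie algebras of linear parts, and preservation of the radical. -/

/-- In characteristic two, block matrices with blocks of size at most two form a solvable Lie
algebra. -/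
theorem exists_chain_of_two_eq_zero {K Q : Type*} [Field K] [Fintype Q] (h2 : (2 : K) = 0)
    (P : Q → Q → Prop) (hsymm : ∀ a b, P a b → P b a)
    (htrans : ∀ a b c, P a b → P b c → P a c)
    (hP : ∀ a b c, P a b → P a c → a ≠ b → a ≠ c → b = c) :
    ∃ g : ℕ → Submodule K (Matrix Q Q K), (∀ m : Matrix Q Q K,
      (∀ a b, a ≠ b → ¬ P a b → m a b = 0) → m ∈ g 0) ∧
      (∀ n, ∀ m ∈ g n, ∀ m' ∈ g n, m * m' - m' * m ∈ g (n + 1)) ∧ g 3 = ⊥ := by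
  have hadd : ∀ k : K, k + k = 0 := fun k => by rw [← two_mul, h2, zero_mul]
  -- On a block of size two the levels are gl₂, then sl₂, then the scalars, then 0. In
  -- characteristic two, trace zero means equal diagonal entries, and brackets of such matrices are
  -- scalar. Blocks of size one vanish from level 1 on.
  refine ⟨fun n =>
    { carrier := {m | (∀ a b, a ≠ b → (¬ P a b ∨ 2 ≤ n) → m a b = 0) ∧
        (1 ≤ n → (∀ a b, a ≠ b → P a b → m a a = m b b) ∧
          ∀ a, ((∀ b, P a b → a = b) ∨ 3 ≤ n) → m a a = 0)}
      add_mem' := by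
        rintro m m' ⟨h1, h3⟩ ⟨h1', h3'⟩
        refine ⟨fun a b h h' => by simp [h1 a b h h', h1' a b h h'], fun h => ⟨fun a b hab hp => ?_,
          fun a ha => ?_⟩⟩
        · simp [(h3 h).1 a b hab hp, (h3' h).1 a b hab hp]
        · simp [(h3 h).2 a ha, (h3' h).2 a ha]
      zero_mem' := ⟨fun _ _ _ _ => rfl, fun _ => ⟨fun _ _ _ _ => rfl, fun _ _ => rfl⟩⟩
      smul_mem' := by
        rintro c m ⟨h1, h3⟩
        refine ⟨fun a b h h' => by simp [h1 a b h h'], fun h => ⟨fun a b hab hp => ?_,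
          fun a ha => ?_⟩⟩
        · simp [(h3 h).1 a b hab hp]
        · simp [(h3 h).2 a ha] }, ?_, ?_, ?_⟩
  · intro m hm
    exact ⟨fun a b hab h => hm a b hab (h.resolve_right (by omega)), fun h => absurd h (by omega)⟩
  · rintro n m ⟨h1, h3⟩ m' ⟨h1', h3'⟩
    have hpair : ∀ a b c : Q, P a b → a ≠ b → ∀ m m' : Matrix Q Q K,
        (∀ a b, a ≠ b → ¬ P a b → m a b = 0) →
        (m * m') a c = m a a * m' a c + m a b * m' b c := by
      intro a b c hp hab m m' hm
      rw [Matrix.mul_apply, Fintype.sum_eq_add a b hab]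
      rintro x ⟨hxa, hxb⟩
      rw [hm a x hxa.symm fun hpx => hxb (hP a x b hpx hp hxa.symm hab), zero_mul]
    have hsingle : ∀ a c : Q, (∀ b, P a b → a = b) → ∀ m m' : Matrix Q Q K,
        (∀ a b, a ≠ b → ¬ P a b → m a b = 0) → (m * m') a c = m a a * m' a c := by
      intro a c ha m m' hm
      rw [Matrix.mul_apply, Fintype.sum_eq_single a]
      intro x hx
      rw [hm a x hx.symm fun hpx => hx.symm (ha x hpx), zero_mul]
    have h0 : ∀ a b, a ≠ b → ¬ P a b → m a b = 0 := fun a b h h' => h1 a b h (Or.inl h')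
    have h0' : ∀ a b, a ≠ b → ¬ P a b → m' a b = 0 := fun a b h h' => h1' a b h (Or.inl h')
    have hdiag : ∀ a b, a ≠ b → P a b → (m * m' - m' * m) a a = m a b * m' b a - m' a b * m b a := by
      intro a b hab hp
      rw [Matrix.sub_apply, hpair a b a hp hab m m' h0, hpair a b a hp hab m' m h0']
      ring
    have hdiag0 : ∀ a, (∀ b, P a b → a = b) → (m * m' - m' * m) a a = 0 := by
      intro a ha
      rw [Matrix.sub_apply, hsingle a a ha m m' h0, hsingle a a ha m' m h0']
      ring
    refine ⟨fun a b hab h => ?_, fun _ => ⟨fun a b hab hp => ?_, fun a ha => ?_⟩⟩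
    · by_cases hp : P a b
      · have hn : 1 ≤ n := by
          rcases h with h | h
          · exact absurd hp h
          · omega
        rw [Matrix.sub_apply, hpair a b b hp hab m m' h0, hpair a b b hp hab m' m h0',
          (h3 hn).1 a b hab hp, (h3' hn).1 a b hab hp]
        linear_combination hadd (m b b * m' a b) - hadd (m' b b * m a b) -
          hadd (m b b * m' a b) + hadd (m' b b * m a b)
      · have hz : ∀ m m' : Matrix Q Q K, (∀ a b, a ≠ b → ¬ P a b → m a b = 0) →
            (∀ a b, a ≠ b → ¬ P a b → m' a b = 0) → ∀ c, m a c * m' c b = m a a * m' a b * 0 := by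
          intro m m' hm hm' c
          rw [mul_zero]
          by_cases hac : a = c
          · subst hac
            rw [hm' a b hab hp, mul_zero]
          by_cases hpc : P a c
          · by_cases hcb : c = b
            · exact absurd (hcb ▸ hpc) hp
            · rw [hm' c b hcb fun hq => hp (htrans _ _ _ hpc hq), mul_zero]
          · rw [hm a c hac hpc, zero_mul]
        rw [Matrix.sub_apply, Matrix.mul_apply, Matrix.mul_apply,
          Finset.sum_eq_zero fun c _ => (hz m m' h0 h0' c).trans (mul_zero _),
          Finset.sum_eq_zero fun c _ => (hz m' m h0' h0 c).trans (mul_zero _), sub_zero]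
    · rw [hdiag a b hab hp, hdiag b a hab.symm (hsymm _ _ hp)]
      linear_combination hadd (m a b * m' b a) - hadd (m' a b * m b a)
    · rcases ha with ha | ha
      · exact hdiag0 a ha
      · by_cases hex : ∃ b, a ≠ b ∧ P a b
        · obtain ⟨b, hab, hp⟩ := hex
          rw [hdiag a b hab hp, h1 a b hab (Or.inr (by omega)), h1' a b hab (Or.inr (by omega))]
          ring
        · push Not at hex
          exact hdiag0 a fun b hp => by_contra fun hne => hex b hne hp
  · rw [eq_bot_iff]
    rintro m ⟨h1, h3⟩
    rw [Submodule.mem_bot]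
    ext a b
    by_cases hab : a = b
    · subst hab
      exact (h3 (by omega)).2 a (Or.inr le_rfl)
    · exact h1 a b hab (Or.inr (by omega))

namespace BrauerGraph

variable {V E : Type} {G : BrauerGraph V E} {K : Type*} [Field K] [Fintype E] [DecidableEq E]

/-- The blocks consist of the arrows with a common source; these come from the two halves of one
edge, so there are at most two of them. -/
theorem isSolvable_of_two_eq_zero (h2 : (2 : K) = 0)
    (hrad : ∀ d ∈ algDer K (G.Alg K), (∀ i, d (G.idem K i) = 0) → ∀ a : G.Arrow, a.src = a.tgt →
      G.augmentation K (d (G.arrow K a)) a.src = 0) :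
    LieAlgebra.IsSolvable (HH1 K (G.Alg K)) := by
  obtain ⟨g, hg0, hg, h3⟩ := exists_chain_of_two_eq_zero (Q := G.Arrow) h2
    (fun a b => a.src = b.src) (fun _ _ => Eq.symm) (fun _ _ _ => Eq.trans)
    (fun a b c hab hac hb hc => Arrow.ext'
      ((eq_flip_of_src_eq hb hab).trans (eq_flip_of_src_eq hc hac).symm))
  refine isSolvable_of_linearPart hrad g 3 (fun d hd he => hg0 _ fun a b _ h => ?_) hg h3
  exact coeff_derivation_of_src_ne hd he (Ne.symm h)

/-- In odd characteristic the only obstruction is a pair of parallel arrows in maximal paths of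
length two. -/
theorem isSolvable_of_len_ne_two
    (hrad : ∀ d ∈ algDer K (G.Alg K), (∀ i, d (G.idem K i) = 0) → ∀ a : G.Arrow, a.src = a.tgt →
      G.augmentation K (d (G.arrow K a)) a.src = 0)
    (hlen : ∀ a b : G.Arrow, a ≠ b → a.src = b.src → a.tgt = b.tgt →
      G.len a.1 = 2 → G.len b.1 ≠ 2) :
    LieAlgebra.IsSolvable (HH1 K (G.Alg K)) := by
  have hlen2 : ∀ a b : G.Arrow, a ≠ b → a.src = b.src → 2 ≤ G.len a.1 := by
    intro a b hab hs
    exact G.two_le_len a.2 (eq_flip_of_src_eq hab hs ▸ b.2)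
  -- Two composable pairs of this relation would end in two parallel arrows of length two, against
  -- `hlen`.
  refine isSolvable_of_triangular hrad
    (fun a b => a ≠ b ∧ a.src = b.src ∧ a.tgt = b.tgt ∧ G.len b.1 = 2) ?_ ?_
  · rintro a b c ⟨hab, hs, ht, hb⟩ ⟨hbc, hs', ht', hc⟩
    exact hlen b c hbc hs' ht' hb hc
  · intro d hd he a b hab h
    by_cases hs : a.src = b.src
    swap
    · exact coeff_derivation_of_src_ne hd he (Ne.symm hs)
    by_cases ht : a.tgt = b.tgt
    swap
    · exact coeff_derivation_of_tgt_ne hd he (Ne.symm ht)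
    refine coeff_derivation_of_three_le hd he hab ?_
    have h1 := hlen2 b a hab.symm hs.symm
    have h3 : G.len b.1 ≠ 2 := fun h3 => h ⟨hab, hs, ht, h3⟩
    omega

/-- Derivations preserve the radical unless the algebra is a truncated polynomial algebra. -/
theorem augmentation_derivation_eq_zero
    (h2 : (2 : K) ≠ 0 ∨ ∀ a : G.Arrow, a.src = a.tgt → G.arrow K a ^ 2 ≠ 0)
    (hpoly : ∀ a : G.Arrow, G.next a.1 = a.1 → G.IsArrow (flip a.1))
    {d : Module.End K (G.Alg K)} (hd : d ∈ algDer K (G.Alg K)) {a : G.Arrow}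
    (ha : a.src = a.tgt) : G.augmentation K (d (G.arrow K a)) a.src = 0 := by
  -- A loop is followed around its vertex either by its own half-edge or by the opposite one.
  rcases eq_or_eq_flip_of_fst_eq (ha.symm : (G.next a.1).1 = a.1.1) with h | h
  · exact augmentation_derivation_of_next_eq hd h (hpoly a h)
  · rcases h2 with h2 | h2
    · exact (mul_eq_zero.1 (two_mul_augmentation_derivation hd h)).resolve_left h2
    · refine absurd ?_ (h2 a ha)
      rw [pow_two]
      exact arrow_mul_turn G K a a (by rw [h, flip_flip])

end BrauerGraph

/-! ### Algebras with one generator. -/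

section OneGenerator

variable {K A : Type*} [Field K] [Ring A] [Algebra K A]

theorem exists_aeval_of_adjoin_eq_top {x : A} (hx : Algebra.adjoin K {x} = ⊤) (y : A) :
    ∃ q : K[X], Polynomial.aeval x q = y := by
  have : y ∈ Algebra.adjoin K {x} := hx ▸ Algebra.mem_top
  rwa [Algebra.adjoin_singleton_eq_range_aeval] at this

/-- An algebra generated by one element is commutative, so the usual chain rule holds. -/
theorem derivation_aeval {x : A} (hx : Algebra.adjoin K {x} = ⊤) {d : Module.End K A}
    (hd : d ∈ algDer K A) (p : K[X]) :
    d (Polynomial.aeval x p) = Polynomial.aeval x (Polynomial.derivative p) * d x := by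
  have h : ∀ x y, d (x * y) = d x * y + x * d y := hd
  have h1 : d 1 = 0 := by simpa using h 1 1
  obtain ⟨q, hq⟩ := exists_aeval_of_adjoin_eq_top hx (d x)
  have hcomm : d x * x = x * d x := by
    rw [← hq]
    simpa using congrArg (Polynomial.aeval x) (mul_comm q Polynomial.X)
  have hpow : ∀ n : ℕ, d (x ^ n) = (n : A) * x ^ (n - 1) * d x := by
    intro n
    induction n with
    | zero => simp [h1]
    | succ n ih =>
      rw [pow_succ, h, ih]
      cases n with
      | zero => simp
      | succ n =>
        rw [mul_assoc, hcomm, Nat.add_sub_cancel, Nat.add_sub_cancel, ← mul_assoc,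
          mul_assoc ((n + 1 : ℕ) : A), ← pow_succ]
        push_cast
        noncomm_ring
  induction p using Polynomial.induction_on' with
  | add p q hp hq => simp [hp, hq, add_mul]
  | monomial n c =>
    rw [Polynomial.aeval_monomial, ← Algebra.smul_def, map_smul, hpow,
      Polynomial.derivative_monomial, Polynomial.aeval_monomial, map_mul, map_natCast,
      Algebra.smul_def]
    simp only [mul_assoc]

/-- Only odd exponents survive differentiation in characteristic two, and they become even. -/
theorem exists_derivative_eq_comp_sq (h2 : (2 : K) = 0) (p : K[X]) :
    ∃ s : K[X], Polynomial.derivative p = s.comp (Polynomial.X ^ 2) := by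
  induction p using Polynomial.induction_on' with
  | add p q hp hq =>
    obtain ⟨s, hs⟩ := hp
    obtain ⟨t, ht⟩ := hq
    exact ⟨s + t, by simp [hs, ht]⟩
  | monomial n c =>
    rw [Polynomial.derivative_monomial]
    rcases Nat.even_or_odd' n with ⟨k, rfl | rfl⟩
    · exact ⟨0, by simp [h2]⟩
    · refine ⟨Polynomial.monomial k c, ?_⟩
      rw [Polynomial.monomial_comp, ← pow_mul, Nat.add_sub_cancel,
        ← Polynomial.C_mul_X_pow_eq_monomial]
      simp [h2]

/-- In characteristic two, an algebra generated by one element has a solvable first Hochschild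
cohomology. -/
theorem isSolvable_HH1_of_adjoin_singleton (h2 : (2 : K) = 0) {x : A}
    (hx : Algebra.adjoin K {x} = ⊤) : LieAlgebra.IsSolvable (HH1 K A) := by
  -- If `d x = q(x)` and `d' x = q'(x)`, the bracket sends `x` to the derivative of the product of
  -- `q` and `q'`, signs being irrelevant; this is a polynomial in `x²`. Every derivation kills
  -- `x²`, so brackets of derivations with values at `x` in `K[x²]` vanish.
  let Q : ℕ → Submodule K (Module.End K A) := fun n =>
    match n with
    | 0 => ⊤
    | 1 => (LinearMap.range (Polynomial.aeval (R := K) (x ^ 2)).toLinearMap).comap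
        (LinearMap.applyₗ x)
    | _ => ⊥
  refine isSolvable_HH1_of_chain Q (fun d _ => ⟨0, Submodule.mem_top⟩) ?_ 2 rfl
  intro n d hd d' hd' h h'
  obtain ⟨q, hq⟩ := exists_aeval_of_adjoin_eq_top hx (d x)
  obtain ⟨q', hq'⟩ := exists_aeval_of_adjoin_eq_top hx (d' x)
  match n with
  | 0 =>
    obtain ⟨s, hs⟩ := exists_derivative_eq_comp_sq h2 (q * q')
    refine ⟨s, ?_⟩
    have h3 : (2 : K[X]) = 0 := by
      rw [← map_ofNat Polynomial.C 2, h2, map_zero]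
    have h4 : Polynomial.derivative q' * q - Polynomial.derivative q * q' =
        s.comp (Polynomial.X ^ 2) := by
      rw [← hs, Polynomial.derivative_mul]
      linear_combination (-Polynomial.derivative q * q') * h3
    have h5 := congrArg (Polynomial.aeval x) h4
    rw [map_sub, map_mul, map_mul, Polynomial.aeval_comp, map_pow, Polynomial.aeval_X] at h5
    change Polynomial.aeval (x ^ 2) s = d (d' x) - d' (d x)
    have h6 : d (d' x) = Polynomial.aeval x (Polynomial.derivative q') * Polynomial.aeval x q := by
      rw [← hq', derivation_aeval hx hd, hq]
    have h7 : d' (d x) = Polynomial.aeval x (Polynomial.derivative q) * Polynomial.aeval x q' := by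
      rw [← hq, derivation_aeval hx hd', hq']
    rw [h6, h7, h5]
  | 1 =>
    have hz : ∀ d ∈ algDer K A, ∀ s : K[X], d (Polynomial.aeval (x ^ 2) s) = 0 := by
      intro d hd s
      have h4 : Polynomial.aeval (x ^ 2) s = Polynomial.aeval x (s.comp (Polynomial.X ^ 2)) := by
        rw [Polynomial.aeval_comp]
        simp
      rw [h4, derivation_aeval hx hd, Polynomial.derivative_comp]
      simp [one_add_one_eq_two, h2]
    obtain ⟨s, hs⟩ := h
    obtain ⟨s', hs'⟩ := h'
    have hs : Polynomial.aeval (x ^ 2) s = d x := hs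
    have hs' : Polynomial.aeval (x ^ 2) s' = d' x := hs'
    refine (Submodule.mem_bot K).2 (LinearMap.ext fun y => ?_)
    obtain ⟨p, rfl⟩ := exists_aeval_of_adjoin_eq_top hx y
    let := endLieRing K A
    have h6 : d * d' - d' * d ∈ algDer K A := (algDer K A).lie_mem hd hd'
    rw [derivation_aeval hx h6]
    simp [← hs, ← hs', hz d hd, hz d' hd']
  | n + 2 =>
    have h : d = 0 := (Submodule.mem_bot K).1 h
    rw [h]
    exact (Submodule.mem_bot K).2 (by simp)

end OneGenerator

/-! ### A single edge with a truncated end: truncated polynomial algebras. -/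

namespace BrauerGraph

variable {V E : Type} {G : BrauerGraph V E} {a : G.Arrow}

theorem cyc_of_loop (ha : G.next a.1 = a.1) {B : Type*} [Monoid B] (x : G.Arrow → B) (n : ℕ) :
    Arrow.cyc x a n = x a ^ n := by
  have h : ∀ n, Arrow.next^[n] a = a := fun n => Function.iterate_fixed (Arrow.ext' ha) n
  induction n with
  | zero => simp [Arrow.cyc_zero]
  | succ n ih => rw [Arrow.cyc_succ, h, ih, pow_succ]

variable [Fintype E]

/-- A half-edge without an arrow is truncated, hence fixed by `next`. The two halves are then closed
under `flip` and `next`, and connectedness leaves nothing else. -/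
theorem half_edge_eq_of_loop (ha : G.next a.1 = a.1) (hf : ¬ G.IsArrow (flip a.1))
    (h : E × Bool) : h = a.1 ∨ h = flip a.1 := by
  have ht : G.len (flip a.1) = 1 := by
    rw [← truncated_iff]
    by_contra H
    exact hf (Or.inl H)
  refine G.half_edge_induction (fun h => h = a.1 ∨ h = flip a.1) (Or.inl rfl) ?_ ?_ h
  · rintro _ (rfl | rfl)
    · exact Or.inr rfl
    · exact Or.inl (flip_flip _)
  · rintro _ (rfl | rfl)
    · exact Or.inl ha
    · exact Or.inr (G.next_eq_of_len_eq_one ht)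

theorem edge_eq_of_loop (ha : G.next a.1 = a.1) (hf : ¬ G.IsArrow (flip a.1)) (i : E) :
    i = a.src := by
  rcases half_edge_eq_of_loop ha hf (i, false) with h | h
  · exact congrArg Prod.fst h
  · exact congrArg Prod.fst (h : (i, false) = (a.1.1, !a.1.2))

theorem arrow_eq_of_loop (ha : G.next a.1 = a.1) (hf : ¬ G.IsArrow (flip a.1)) (b : G.Arrow) :
    b = a :=
  Arrow.ext' ((half_edge_eq_of_loop ha hf b.1).resolve_right fun h => hf (h ▸ b.2))

variable (K : Type*) [Field K]

theorem idem_of_loop (ha : G.next a.1 = a.1) (hf : ¬ G.IsArrow (flip a.1)) (i : E) :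
    G.idem K i = 1 := by
  rw [← G.sum_idem K, Fintype.sum_eq_single i]
  intro j hj
  exact absurd ((edge_eq_of_loop ha hf j).trans (edge_eq_of_loop ha hf i).symm) hj

theorem adjoin_of_loop (ha : G.next a.1 = a.1) (hf : ¬ G.IsArrow (flip a.1)) :
    Algebra.adjoin K {G.arrow K a} = ⊤ := by
  rw [eq_top_iff, ← G.adjoin_eq_top K, Algebra.adjoin_le_iff]
  rintro _ (⟨i, rfl⟩ | ⟨b, rfl⟩)
  · rw [idem_of_loop K ha hf]
    exact one_mem _
  · rw [arrow_eq_of_loop ha hf b]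
    exact Algebra.subset_adjoin rfl

/-- The Brauer graph algebra of a single edge with a truncated end. -/
noncomputable def equivTruncatedPolynomial [DecidableEq E] (ha : G.next a.1 = a.1)
    (hf : ¬ G.IsArrow (flip a.1)) :
    G.Alg K ≃ₐ[K] K[X] ⧸ Ideal.span {(Polynomial.X : K[X]) ^ (G.len a.1 + 1)} :=
  let I := Ideal.span {(Polynomial.X : K[X]) ^ (G.len a.1 + 1)}
  have hX : Ideal.Quotient.mk I Polynomial.X ^ (G.len a.1 + 1) = 0 := by
    rw [← map_pow, Ideal.Quotient.eq_zero_iff_mem]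
    exact Ideal.mem_span_singleton_self _
  let f : G.Alg K →ₐ[K] K[X] ⧸ I := lift (fun _ => 1) (fun _ => Ideal.Quotient.mk I Polynomial.X)
    (fun i j => by
      rw [if_pos ((edge_eq_of_loop ha hf i).trans (edge_eq_of_loop ha hf j).symm), mul_one])
    (by rw [Fintype.sum_eq_single a.src fun i hi => absurd (edge_eq_of_loop ha hf i) hi])
    (fun _ => one_mul _) (fun _ => mul_one _)
    (fun b c h => by
      rw [arrow_eq_of_loop ha hf b] at h
      exact absurd (h ▸ c.2) hf)
    (fun b _ => by rw [arrow_eq_of_loop ha hf b, cyc_of_loop ha, ← pow_succ, hX])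
    (fun b c h => by
      rw [arrow_eq_of_loop ha hf b, ha] at h
      exact absurd (h ▸ c.2) hf)
  have hx : Polynomial.aeval (G.arrow K a) ((Polynomial.X : K[X]) ^ (G.len a.1 + 1)) = 0 := by
    rw [map_pow, Polynomial.aeval_X, ← cyc_of_loop ha, G.cyc_eq_zero K (Nat.lt_succ_self _)]
  let g : K[X] ⧸ I →ₐ[K] G.Alg K := Ideal.Quotient.liftₐ I (Polynomial.aeval (G.arrow K a)) (by
    intro p hp
    obtain ⟨q, rfl⟩ := Ideal.mem_span_singleton.1 hp
    rw [map_mul, hx, zero_mul])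
  have hf' : f (G.arrow K a) = Ideal.Quotient.mk I Polynomial.X := lift_arrow ..
  have hg' : g (Ideal.Quotient.mk I Polynomial.X) = G.arrow K a := by
    change Polynomial.aeval (G.arrow K a) Polynomial.X = _
    simp
  AlgEquiv.ofAlgHom f g
    (by
      refine Ideal.Quotient.algHom_ext _ (Polynomial.algHom_ext ?_)
      change f (g (Ideal.Quotient.mk I Polynomial.X)) = Ideal.Quotient.mk I Polynomial.X
      rw [hg', hf'])
    (algHom_ext G K (B := G.Alg K) (f := g.comp f) (g := AlgHom.id K (G.Alg K))
      (fun i => by rw [idem_of_loop K ha hf, map_one, map_one])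
      (fun b => by
        rw [arrow_eq_of_loop ha hf b]
        change g (f (G.arrow K a)) = G.arrow K a
        rw [hf', hg']))

theorem equivTruncatedPolynomial_arrow [DecidableEq E] (ha : G.next a.1 = a.1)
    (hf : ¬ G.IsArrow (flip a.1)) : equivTruncatedPolynomial K ha hf (G.arrow K a) =
      Ideal.Quotient.mk _ Polynomial.X :=
  lift_arrow ..

theorem arrow_pow_len_ne_zero (ha : G.next a.1 = a.1) (hf : ¬ G.IsArrow (flip a.1)) :
    G.arrow K a ^ G.len a.1 ≠ 0 := by
  classical
  intro h
  have h1 := congrArg (equivTruncatedPolynomial K ha hf) h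
  rw [map_pow, equivTruncatedPolynomial_arrow, map_zero, ← map_pow,
    Ideal.Quotient.eq_zero_iff_mem, Ideal.mem_span_singleton,
    pow_dvd_pow_iff Polynomial.X_ne_zero Polynomial.not_isUnit_X] at h1
  omega

/-- The case of a truncated polynomial algebra whose degree is invertible. -/
theorem isSolvable_of_loop (ha : G.next a.1 = a.1) (hf : ¬ G.IsArrow (flip a.1))
    (hn : ((G.len a.1 + 1 : ℕ) : K) ≠ 0) : LieAlgebra.IsSolvable (HH1 K (G.Alg K)) := by
  classical
  refine isSolvable_of_triangular ?_ (fun _ _ => False) (fun _ _ _ h => h.elim)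
    (fun d _ _ b c hbc => absurd ((arrow_eq_of_loop ha hf b).trans
      (arrow_eq_of_loop ha hf c).symm) hbc)
  intro d hd _ b _
  rw [arrow_eq_of_loop ha hf b]
  set x := G.arrow K a with hxdef
  have hx := adjoin_of_loop K ha hf
  have hx0 : x ^ (G.len a.1 + 1) = 0 := by
    rw [hxdef, ← cyc_of_loop ha, G.cyc_eq_zero K (Nat.lt_succ_self _)]
  obtain ⟨q, hq⟩ := exists_aeval_of_adjoin_eq_top hx (d x)
  have h1 : G.augmentation K (d x) a.src = q.coeff 0 := by
    have h2 : G.augmentation K (Polynomial.aeval x q) =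
        Polynomial.aeval (G.augmentation K x) q := (Polynomial.aeval_algHom_apply _ _ _).symm
    rw [← hq, h2, augmentation_arrow, ← Polynomial.coeff_zero_eq_aeval_zero']
    simp
  have h3 : x ^ G.len a.1 * d x = q.coeff 0 • x ^ G.len a.1 := by
    rw [← hq, ← Polynomial.X_mul_divX_add q, map_add, map_mul, Polynomial.aeval_X, mul_add,
      ← mul_assoc, ← pow_succ, hx0, zero_mul, zero_add, Polynomial.aeval_C, Algebra.smul_def,
      (Algebra.commutes _ _).symm]
    simp
  -- With `n = G.len a.1 + 1`, differentiating `x ^ n = 0` gives `n * q(0) * x ^ (n - 1) = 0`, where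
  -- `d x = q(x)`; the power is nonzero and `n` is invertible, so the constant term is zero.
  have h4 := derivation_aeval hx hd (Polynomial.X ^ (G.len a.1 + 1))
  rw [map_pow, Polynomial.aeval_X, hx0, map_zero, Polynomial.derivative_X_pow, map_mul, map_pow,
    Polynomial.aeval_X, Nat.add_sub_cancel, mul_assoc, h3, Polynomial.aeval_C, ← Algebra.smul_def,
    smul_smul, eq_comm, smul_eq_zero] at h4
  rw [h1]
  exact (mul_eq_zero.1 (h4.resolve_right (arrow_pow_len_ne_zero K ha hf))).resolve_left hn

end BrauerGraph

/-! ### The local case: a single edge carrying two loops of length two. -/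

namespace BrauerGraph

variable {V E : Type} {G : BrauerGraph V E} {K : Type*} [Field K] [Fintype E]

theorem Arrow.next_next_of_len (hlen : ∀ c : G.Arrow, G.len c.1 = 2) (c : G.Arrow) :
    c.next.next = c := by
  have := c.iterate_next_len
  rwa [hlen] at this

theorem eq_zero_of_mem_powersFrom_three (hlen : ∀ c : G.Arrow, G.len c.1 = 2) {y : G.Alg K}
    (hy : y ∈ powersFrom (K := K) (A := G.Alg K) (G.arrows K) 3) : y = 0 := by
  have : powersFrom (K := K) (A := G.Alg K) (G.arrows K) 3 ≤ ⊥ := by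
    refine powersFrom_le fun k hk => ?_
    obtain ⟨k, rfl⟩ : ∃ n, k = n + 1 := ⟨k - 1, by omega⟩
    refine (G.arrows_pow_le K k).trans ?_
    rw [Submodule.span_le]
    rintro _ ⟨a, rfl⟩
    exact G.cyc_eq_zero K (by rw [hlen]; omega)
  exact (Submodule.mem_bot K).1 (this hy)

theorem arrow_mem_powersFrom (c : G.Arrow) :
    G.arrow K c ∈ powersFrom (K := K) (A := G.Alg K) (G.arrows K) 1 :=
  pow_le_powersFrom (K := K) (A := G.Alg K) _ le_rfl (by
    rw [pow_one]
    exact Submodule.subset_span ⟨c, rfl⟩)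

variable [DecidableEq E]

theorem derivation_mul_eq {A : Type*} [Ring A] [Algebra K A] {d : Module.End K A}
    (hd : d ∈ algDer K A) {p q y z w w' : A} {c₁ c₂ c₃ c₄ : K} (h : d y = c₁ • p + c₂ • q + w)
    (h' : d z = c₃ • p + c₄ • q + w') (h0 : w * z = 0) (h0' : y * w' = 0) :
    d (y * z) = c₁ • (p * z) + c₂ • (q * z) + (c₃ • (y * p) + c₄ • (y * q)) := by
  rw [hd, h, h', add_mul, add_mul, mul_add, mul_add, h0, h0', add_zero, add_zero, smul_mul_assoc,
    smul_mul_assoc, mul_smul_comm, mul_smul_comm]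

theorem eq_of_smul_eq_smul {A : Type*} [Ring A] [Algebra K A] {r s : K} {y : A} (hy : y ≠ 0)
    (h : r • y = s • y) : r = s :=
  smul_left_injective K hy h

theorem mem_powersFrom_one_of_augmentation_eq_zero {y : G.Alg K} (hy : G.augmentation K y = 0) :
    y ∈ powersFrom (K := K) (A := G.Alg K) (G.arrows K) 1 := by
  have htop := span_sup_powersFrom_eq_top (K := K) (A := G.Alg K) (G.idem_mul_idem K) (G.sum_idem K) (G.idem_src_mul K)
    (G.mul_idem_tgt K) (G.adjoin_eq_top K)
  obtain ⟨z, hz, w, hw, rfl⟩ := Submodule.mem_sup.1 (htop ▸ Submodule.mem_top :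
    y ∈ Submodule.span K (Set.range (G.idem K)) ⊔
      powersFrom (K := K) (A := G.Alg K) (G.arrows K) 1)
  obtain ⟨c, rfl⟩ := (Submodule.mem_span_range_iff_exists_fun K).1 hz
  have hw0 : G.augmentation K w = 0 := by
    have : powersFrom (K := K) (A := G.Alg K) (G.arrows K) 1 ≤
        LinearMap.ker (G.augmentation K).toLinearMap := by
      refine powersFrom_le fun k hk => ?_
      obtain ⟨k, rfl⟩ := Nat.exists_eq_add_of_le' hk
      rw [pow_succ, Submodule.mul_le]
      intro a _ b hb
      simp [augmentation_eq_zero_of_mem_arrows hb]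
    exact this hw
  have hc : ∀ i, c i = 0 := by
    intro i
    have := congrFun hy i
    simpa [augmentation_idem, hw0, Pi.single_apply] using this
  simpa [hc, arrows] using hw

section Local

variable [Subsingleton E]

/-- The nilpotent matrices representing the arrows when all maximal paths have length two. -/
noncomputable def localArrow (K : Type*) [Field K] (c : G.Arrow) :
    Matrix (Fin 2 ⊕ G.Arrow) (Fin 2 ⊕ G.Arrow) K :=
  Matrix.single (Sum.inl 0) (Sum.inr c) 1 + Matrix.single (Sum.inr c.next) (Sum.inl 1) 1

theorem localArrow_mul (hlen : ∀ c : G.Arrow, G.len c.1 = 2) (c c' : G.Arrow) :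
    localArrow K c * localArrow K c' =
      if c' = c.next then Matrix.single (Sum.inl 0) (Sum.inl 1) 1 else 0 := by
  have h : c' = c.next ↔ c = c'.next := by
    constructor <;> rintro rfl <;> rw [Arrow.next_next_of_len hlen]
  rw [localArrow, localArrow, add_mul, mul_add, mul_add,
    Matrix.single_mul_single_of_ne (h := Sum.inr_ne_inl),
    Matrix.single_mul_single_of_ne (i := Sum.inr c.next) (h := Sum.inl_ne_inr),
    Matrix.single_mul_single_of_ne (i := Sum.inr c.next) (h := by simp)]
  split_ifs with hc
  · rw [h] at hc
    rw [← hc, Matrix.single_mul_single_same]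
    simp
  · rw [h] at hc
    rw [Matrix.single_mul_single_of_ne _ _ _ _ (by simpa using hc)]
    simp

/-- In the model by the matrices `localArrow` every maximal path maps to the same matrix unit, and
all other products of two arrows map to zero. -/
theorem arrow_mul_arrow_next_ne_zero (hlen : ∀ c : G.Arrow, G.len c.1 = 2)
    (hflip : ∀ c : G.Arrow, G.IsArrow (flip c.1)) (a : G.Arrow) :
    G.arrow K a * G.arrow K a.next ≠ 0 := by
  have hcyc : ∀ c : G.Arrow, Arrow.cyc (localArrow K) c (G.len c.1) =
      Matrix.single (Sum.inl 0) (Sum.inl 1) 1 := by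
    intro c
    rw [hlen, Arrow.cyc_two, localArrow_mul hlen, if_pos rfl]
  let f : G.Alg K →ₐ[K] Matrix (Fin 2 ⊕ G.Arrow) (Fin 2 ⊕ G.Arrow) K :=
    lift (fun _ => 1) (localArrow K) (fun i j => by rw [if_pos (Subsingleton.elim i j), mul_one])
      (Fintype.sum_eq_single a.src fun i hi => absurd (Subsingleton.elim _ _) hi)
      (fun _ => one_mul _) (fun _ => mul_one _) (fun c c' _ => by rw [hcyc, hcyc])
      (fun c hc => absurd (hflip c) hc)
      (fun c c' h => by
        rw [localArrow_mul hlen, if_neg]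
        rintro rfl
        exact flip_ne _ h.symm)
  intro h
  have h1 : f (G.arrow K a * G.arrow K a.next) = Matrix.single (Sum.inl 0) (Sum.inl 1) 1 := by
    rw [map_mul, show f (G.arrow K a) = localArrow K a from lift_arrow ..,
      show f (G.arrow K a.next) = localArrow K a.next from lift_arrow .., localArrow_mul hlen,
      if_pos rfl]
  rw [h, map_zero] at h1
  simpa using congrFun (congrFun h1 (Sum.inl 0)) (Sum.inl 1)

theorem exists_derivation_arrow_eq {d : Module.End K (G.Alg K)}
    (hrad : ∀ a : G.Arrow, G.augmentation K (d (G.arrow K a)) = 0)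
    {a b : G.Arrow} (hab : b ≠ a) (c : G.Arrow) :
    ∃ w ∈ powersFrom (K := K) (A := G.Alg K) (G.arrows K) 2, d (G.arrow K c) =
      coeff a (d (G.arrow K c)) • G.arrow K a + coeff b (d (G.arrow K c)) • G.arrow K b + w := by
  have h := sub_sum_mem_powersFrom (K := K) (A := G.Alg K) (φ := coeff) (x := G.arrow K)
    (fun a b => coeff_arrow b a) (fun b y hy => coeff_eq_zero_of_mem_powersFrom b hy)
    (mem_powersFrom_one_of_augmentation_eq_zero (hrad c))
  rw [Fintype.sum_eq_add a b hab.symm] at h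
  · exact ⟨_, h, by abel⟩
  · rintro x ⟨hxa, hxb⟩
    exact absurd (Arrow.ext' ((eq_flip_of_src_eq hxa (Subsingleton.elim _ _)).trans
      (eq_flip_of_src_eq hxb (Subsingleton.elim _ _)).symm)) hab.symm

/-- The cube of the radical is zero, so only the linear part of `d` matters on a product of two
arrows. -/
theorem derivation_arrow_mul_arrow (hlen : ∀ c : G.Arrow, G.len c.1 = 2)
    {d : Module.End K (G.Alg K)} (hd : d ∈ algDer K (G.Alg K))
    (hrad : ∀ a : G.Arrow, G.augmentation K (d (G.arrow K a)) = 0)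
    {a b : G.Arrow} (hab : b ≠ a) (c c' : G.Arrow) : d (G.arrow K c * G.arrow K c') =
      coeff a (d (G.arrow K c)) • (G.arrow K a * G.arrow K c') +
      coeff b (d (G.arrow K c)) • (G.arrow K b * G.arrow K c') +
      (coeff a (d (G.arrow K c')) • (G.arrow K c * G.arrow K a) +
      coeff b (d (G.arrow K c')) • (G.arrow K c * G.arrow K b)) := by
  obtain ⟨w, hw, h⟩ := exists_derivation_arrow_eq hrad hab c
  obtain ⟨w', hw', h'⟩ := exists_derivation_arrow_eq hrad hab c'
  have h0 := mul_mem_powersFrom (K := K) (A := G.Alg K) hw (arrow_mem_powersFrom c')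
  have h0' := mul_mem_powersFrom (K := K) (A := G.Alg K) (arrow_mem_powersFrom c) hw'
  exact derivation_mul_eq (K := K) (A := G.Alg K) hd h h' (eq_zero_of_mem_powersFrom_three hlen h0)
    (eq_zero_of_mem_powersFrom_three hlen h0')

theorem isSolvable_of_local (h2 : (2 : K) ≠ 0) (hlen : ∀ c : G.Arrow, G.len c.1 = 2)
    (hflip : ∀ c : G.Arrow, G.IsArrow (flip c.1)) :
    LieAlgebra.IsSolvable (HH1 K (G.Alg K)) := by
  have hrad : ∀ d ∈ algDer K (G.Alg K), (∀ i, d (G.idem K i) = 0) → ∀ a : G.Arrow,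
      G.augmentation K (d (G.arrow K a)) = 0 := by
    intro d hd _ a
    ext i
    rw [Subsingleton.elim i a.src]
    exact augmentation_derivation_eq_zero (Or.inl h2) (fun a _ => hflip a) hd
      (Subsingleton.elim _ _)
  have hmul := fun d (hd : d ∈ algDer K (G.Alg K)) (he : ∀ i, d (G.idem K i) = 0)
    (a b : G.Arrow) (hab : b ≠ a) => derivation_arrow_mul_arrow hlen hd (hrad d hd he) hab
  have hcycle : ∀ a b : G.Arrow, b ≠ a →
      G.arrow K a * G.arrow K a.next = G.arrow K b * G.arrow K b.next := by
    intro a b hab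
    have h := G.cyc_eq_cyc K a b (eq_flip_of_src_eq hab.symm (Subsingleton.elim _ _))
    rwa [hlen, hlen, Arrow.cyc_two, Arrow.cyc_two] at h
  have hne := fun a => arrow_mul_arrow_next_ne_zero (K := K) hlen hflip a
  -- Either both arrows are their own successors, with relations `a² = b²` and `ab = ba = 0`, or
  -- they succeed each other, with relations `a² = b² = 0` and `ab = ba`.
  by_cases hfix : ∀ a : G.Arrow, a.next = a
  · have hab0 : ∀ a b : G.Arrow, b ≠ a → G.arrow K a * G.arrow K b = 0 := fun a b hab =>
      G.arrow_mul_arrow_of_ne K (by rwa [hfix])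
    have key : ∀ d ∈ algDer K (G.Alg K), (∀ i, d (G.idem K i) = 0) → ∀ a b : G.Arrow, b ≠ a →
        coeff a (d (G.arrow K a)) = coeff b (d (G.arrow K b)) ∧
        coeff b (d (G.arrow K a)) = - coeff a (d (G.arrow K b)) := by
      intro d hd he a b hab
      have hsq := hcycle a b hab
      have hs := hne a
      rw [hfix] at hs
      rw [hfix, hfix] at hsq
      have h1 := congrArg d hsq
      rw [hmul d hd he a b hab, hmul d hd he a b hab, hab0 a b hab, hab0 b a hab.symm,
        ← hsq] at h1
      have h3 := congrArg d (hab0 a b hab)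
      rw [map_zero, hmul d hd he a b hab, hab0 a b hab, ← hsq] at h3
      simp only [smul_zero, add_zero, zero_add, ← add_smul] at h1 h3
      constructor
      · have := eq_of_smul_eq_smul (A := G.Alg K) hs h1
        have h5 : (2 : K) * (coeff a (d (G.arrow K a)) - coeff b (d (G.arrow K b))) = 0 := by
          linear_combination this
        exact sub_eq_zero.1 ((mul_eq_zero.1 h5).resolve_left h2)
      · exact eq_neg_of_add_eq_zero_left ((smul_eq_zero.1 h3).resolve_right hs)
    -- By `key` the linear parts have equal diagonal and opposite off-diagonal entries. Such 2×2
    -- matrices commute.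
    let g : ℕ → Submodule K (Matrix G.Arrow G.Arrow K) := fun n =>
      { carrier := {m | (∀ a b, b ≠ a → m a a = m b b ∧ m a b = - m b a) ∧ (1 ≤ n → m = 0)}
        add_mem' := by
          rintro m m' ⟨h1, h3⟩ ⟨h1', h3'⟩
          refine ⟨fun a b h => ⟨?_, ?_⟩, fun h => by rw [h3 h, h3' h, add_zero]⟩
          · simp [(h1 a b h).1, (h1' a b h).1]
          · simp [(h1 a b h).2, (h1' a b h).2, add_comm]
        zero_mem' := ⟨fun _ _ _ => by simp, fun _ => rfl⟩
        smul_mem' := by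
          rintro c m ⟨h1, h3⟩
          refine ⟨fun a b h => ⟨?_, ?_⟩, fun h => by rw [h3 h, smul_zero]⟩
          · simp [(h1 a b h).1]
          · simp [(h1 a b h).2] }
    refine isSolvable_of_linearPart (fun d hd he a _ => by rw [hrad d hd he]; rfl) g 1 ?_ ?_ ?_
    · intro d hd he
      exact ⟨fun a b hab => key d hd he a b hab, fun h => absurd h (by omega)⟩
    · rintro n m ⟨h1, -⟩ m' ⟨h1', -⟩
      have hz : m * m' - m' * m = 0 := by
        ext a b
        let b' : G.Arrow := ⟨flip a.1, hflip a⟩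
        have hb' : b' ≠ a := fun h => flip_ne a.1 (congrArg Subtype.val h)
        have hsum : ∀ f : G.Arrow → K, ∑ c, f c = f a + f b' := by
          intro f
          refine Fintype.sum_eq_add a b' hb'.symm ?_
          rintro x ⟨hxa, hxb⟩
          exact absurd (Arrow.ext' (eq_flip_of_src_eq hxa.symm (Subsingleton.elim _ _))) hxb
        rw [Matrix.sub_apply, Matrix.mul_apply, Matrix.mul_apply, hsum, hsum, Matrix.zero_apply]
        obtain ⟨k1, k2⟩ := h1 a b' hb'
        obtain ⟨k1', k2'⟩ := h1' a b' hb'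
        by_cases hba : b = a
        · subst hba
          rw [k2, k2']
          ring
        · obtain rfl : b = b' :=
            Arrow.ext' (eq_flip_of_src_eq (Ne.symm hba) (Subsingleton.elim _ _))
          rw [k1, k1']
          ring
      rw [hz]
      exact zero_mem _
    · rw [eq_bot_iff]
      rintro m ⟨-, h⟩
      exact h le_rfl
  · refine isSolvable_of_triangular (fun d hd he a _ => by rw [hrad d hd he]; rfl)
      (fun _ _ => False) (fun _ _ _ h => h.elim) ?_
    intro d hd he a b hab _
    have hnext : a.next = b := by
      by_contra hne'
      refine hfix fun c => ?_
      have ha : a.next = a := by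
        by_contra hna
        exact hne' (Arrow.ext' ((eq_flip_of_src_eq (Ne.symm hna) (Subsingleton.elim _ _)).trans
          (eq_flip_of_src_eq hab (Subsingleton.elim _ _)).symm))
      by_contra hc
      have hca : c ≠ a := fun h => hc (h ▸ ha)
      have hcna : c.next ≠ a := fun h => hca (Arrow.next_injective (h.trans ha.symm))
      exact hc (Arrow.ext' ((eq_flip_of_src_eq hcna.symm (Subsingleton.elim _ _)).trans
          (eq_flip_of_src_eq hca.symm (Subsingleton.elim _ _)).symm))
    have hnext' : b.next = a := by rw [← hnext, Arrow.next_next_of_len hlen]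
    have h0 : G.arrow K a * G.arrow K a = 0 :=
      G.arrow_mul_arrow_of_ne K (by rwa [hnext])
    have hcomm := hcycle a b hab.symm
    have hs := hne a
    rw [hnext] at hs
    rw [hnext, hnext'] at hcomm
    -- Differentiating `a² = 0` gives twice the coefficient of `b` in `d a` times the nonzero
    -- element `ab`, so the linear part is diagonal.
    have h1 := congrArg d h0
    rw [map_zero, hmul d hd he a b hab.symm, h0, ← hcomm] at h1
    simp only [smul_zero, zero_add, ← add_smul] at h1
    have h3 := (smul_eq_zero.1 h1).resolve_right hs
    rw [← two_mul] at h3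
    exact (mul_eq_zero.1 h3).resolve_left h2

end Local

end BrauerGraph

/-! ### A presentation of the trivial extension of the Kronecker algebra. -/

/-- The relations of the path algebra of the Kronecker quiver. -/
structure KroneckerRel {A : Type*} [Ring A] (e α : Fin 2 → A) : Prop where
  e_mul_e : ∀ i j, e i * e j = if i = j then e i else 0
  sum_e : ∑ i, e i = 1
  e_mul_α : ∀ i k, e i * α k = if i = 0 then α k else 0
  α_mul_e : ∀ k i, α k * e i = if i = 1 then α k else 0

/-- The relations of the trivial extension of the Kronecker algebra involving the new arrows. -/
structure KroneckerDualRel {A : Type*} [Ring A] (e α c : Fin 2 → A) : Prop where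
  e_mul_c : ∀ i k, e i * c k = if i = 1 then c k else 0
  c_mul_e : ∀ k i, c k * e i = if i = 0 then c k else 0
  α_mul_c : ∀ k l, α k * c l = if k = l then α 0 * c 0 else 0
  c_mul_α : ∀ k l, c k * α l = if k = l then c 0 * α 0 else 0

namespace KroneckerRel

theorem α_mul_α {A : Type*} [Ring A] {e α : Fin 2 → A} (h : KroneckerRel e α) (k l : Fin 2) :
    α k * α l = 0 := by
  have h1 := h.α_mul_e k 1
  have h2 := h.e_mul_α 1 l
  simp only [if_true, one_ne_zero, if_false] at h1 h2
  rw [← h1, mul_assoc, h2, mul_zero]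

variable {K : Type u} [Field K]

/-- The idempotents of the Kronecker algebra. -/
noncomputable def stdE (K : Type u) [Field K] (i : Fin 2) : KroneckerAlgebra K :=
  RingQuot.mkAlgHom K _ (FreeAlgebra.ι K (Sum.inl i))

/-- The arrows of the Kronecker algebra. -/
noncomputable def stdα (K : Type u) [Field K] (k : Fin 2) : KroneckerAlgebra K :=
  RingQuot.mkAlgHom K _ (FreeAlgebra.ι K (Sum.inr k))

theorem std (K : Type u) [Field K] : KroneckerRel (stdE K) (stdα K) := by
  have hee : ∀ i j, stdE K i * stdE K j = if i = j then stdE K i else 0 := by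
    intro i j
    split_ifs with h
    · subst h
      rw [stdE, ← map_mul]
      exact RingQuot.mkAlgHom_rel K (PathAlgebra.Rel.idem i)
    · rw [stdE, stdE, ← map_mul, RingQuot.mkAlgHom_rel K (PathAlgebra.Rel.orth i j h), map_zero]
  have hs : ∀ k, stdE K 0 * stdα K k = stdα K k := by
    intro k
    rw [stdE, stdα, ← map_mul]
    exact RingQuot.mkAlgHom_rel K (PathAlgebra.Rel.src_mul k)
  have ht : ∀ k, stdα K k * stdE K 1 = stdα K k := by
    intro k
    rw [stdE, stdα, ← map_mul]
    exact RingQuot.mkAlgHom_rel K (PathAlgebra.Rel.mul_tgt k)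
  refine ⟨hee, ?_, fun i k => ?_, fun k i => ?_⟩
  · simp only [stdE, ← map_sum]
    rw [RingQuot.mkAlgHom_rel K (PathAlgebra.Rel.sum_eq_one (K := K) (src := fun _ => (0 : Fin 2))
      (tgt := fun _ : Fin 2 => (1 : Fin 2))), map_one]
  · split_ifs with h
    · rw [h, hs]
    · rw [← hs, ← mul_assoc, hee, if_neg h, zero_mul]
  · split_ifs with h
    · rw [h, ht]
    · rw [← ht, mul_assoc, hee, if_neg (Ne.symm h), mul_zero]

theorem exists_lift {A : Type*} [Ring A] [Algebra K A] {e α : Fin 2 → A} (h : KroneckerRel e α) :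
    ∃ f : KroneckerAlgebra K →ₐ[K] A, (∀ i, f (stdE K i) = e i) ∧ ∀ k, f (stdα K k) = α k := by
  refine ⟨RingQuot.liftAlgHom K ⟨FreeAlgebra.lift K (Sum.elim e α), ?_⟩, fun i => ?_, fun k => ?_⟩
  · rintro _ _ (i | ⟨i, j, hij⟩ | _ | a | a)
    · simp [h.e_mul_e]
    · simp [h.e_mul_e, hij]
    · simpa using h.sum_e
    · simp [h.e_mul_α]
    · simp [h.α_mul_e]
  · simp only [stdE, RingQuot.liftAlgHom_mkAlgHom_apply]
    simp
  · simp only [stdα, RingQuot.liftAlgHom_mkAlgHom_apply]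
    simp

theorem adjoin_std (K : Type u) [Field K] :
    Algebra.adjoin K (Set.range (stdE K) ∪ Set.range (stdα K)) = ⊤ := by
  let f : FreeAlgebra K (Fin 2 ⊕ Fin 2) →ₐ[K] KroneckerAlgebra K := RingQuot.mkAlgHom K _
  have hf : Function.Surjective f := RingQuot.mkAlgHom_surjective K _
  have h1 : Set.range (stdE K) ∪ Set.range (stdα K) = f '' Set.range (FreeAlgebra.ι K) := by
    rw [← Set.range_comp, ← Set.Sum.elim_range]
    congr 1
    ext (i | a) <;> rfl
  rw [h1, ← AlgHom.map_adjoin, FreeAlgebra.adjoin_range_ι, Algebra.map_top,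
    (AlgHom.range_eq_top f).2 hf]

theorem span_eq_top {A : Type*} [Ring A] [Algebra K A] {e α : Fin 2 → A} (h : KroneckerRel e α)
    (hgen : Algebra.adjoin K (Set.range e ∪ Set.range α) = ⊤) :
    Submodule.span K (Set.range e ∪ Set.range α) = ⊤ := by
  have h1 := span_sup_powersFrom_eq_top (s := fun _ : Fin 2 => (0 : Fin 2))
    (t := fun _ : Fin 2 => (1 : Fin 2)) h.e_mul_e h.sum_e (fun k => by simp [h.e_mul_α])
    (fun k => by simp [h.α_mul_e]) hgen
  rw [eq_top_iff, ← h1, Submodule.span_union]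
  refine sup_le_sup_left (powersFrom_le fun k hk => ?_) _
  obtain rfl | ⟨k, rfl⟩ : k = 1 ∨ ∃ n, k = n + 2 := by
    rcases hk.eq_or_lt with h | h
    · exact Or.inl h.symm
    · exact Or.inr ⟨k - 2, by omega⟩
  · rw [pow_one]
  · have h2 : Submodule.span K (Set.range α) ^ 2 = ⊥ := by
      rw [pow_two, Submodule.span_mul_span, Submodule.span_eq_bot]
      rintro _ ⟨_, ⟨k, rfl⟩, _, ⟨l, rfl⟩, rfl⟩
      exact h.α_mul_α k l
    rw [pow_add, h2, Submodule.mul_bot]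
    exact bot_le

/-- Linear maps agreeing on a spanning set of vertices and arrows are equal. -/
theorem apply_eq {A W : Type*} [Ring A] [Algebra K A] [AddCommGroup W] [Module K W]
    {e α : Fin 2 → A} (h : KroneckerRel e α)
    (hgen : Algebra.adjoin K (Set.range e ∪ Set.range α) = ⊤) {f g : A →ₗ[K] W}
    (he : ∀ i, f (e i) = g (e i)) (hα : ∀ k, f (α k) = g (α k)) (y : A) : f y = g y := by
  refine LinearMap.congr_fun (LinearMap.ext_on (span_eq_top h hgen) ?_) y
  rintro _ (⟨i, rfl⟩ | ⟨k, rfl⟩)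
  · exact he i
  · exact hα k

/-- The functional is the upper right entry of the representation by 2×2 matrices in which only the
arrow `k` acts nontrivially. These functionals are the new arrows of the trivial extension. -/
theorem exists_dual (K : Type u) [Field K] (k : Fin 2) : ∃ φ : KroneckerAlgebra K →ₗ[K] K,
    (∀ i, φ (stdE K i) = 0) ∧ ∀ l, φ (stdα K l) = if l = k then 1 else 0 := by
  have h : KroneckerRel (fun i : Fin 2 => Matrix.single i i (1 : K))
      (fun l => if l = k then Matrix.single 0 1 (1 : K) else 0) := by
    refine ⟨fun i j => ?_, ?_, fun i l => ?_, fun l i => ?_⟩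
    · split_ifs with h
      · subst h
        simp
      · simp [h]
    · ext i j
      fin_cases i <;> fin_cases j <;> simp
    · fin_cases i <;> split_ifs <;> simp_all
    · fin_cases i <;> split_ifs <;> simp_all
  obtain ⟨f, he, hα⟩ := exists_lift (K := K) h
  refine ⟨(Matrix.entryLinearMap K K 0 1).comp f.toLinearMap, fun i => ?_, fun l => ?_⟩
  · simp [he]
    fin_cases i <;> simp
  · simp [hα]
    split_ifs <;> simp

end KroneckerRel

namespace DualBimodule

variable {K A : Type*} [Field K] [Ring A] [Algebra K A]

theorem toDual_smul (a : A) (f : DualBimodule K A) (y : A) :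
    toDual K A (a • f) y = toDual K A f (y * a) := rfl

theorem toDual_op_smul (a : A) (f : DualBimodule K A) (y : A) :
    toDual K A (MulOpposite.op a • f) y = toDual K A f (a * y) := rfl

theorem toDual_add (f g : DualBimodule K A) (y : A) :
    toDual K A (f + g) y = toDual K A f y + toDual K A g y := rfl

theorem toDual_zero (y : A) : toDual K A (0 : DualBimodule K A) y = 0 := rfl

theorem toDual_base_smul (c : K) (f : DualBimodule K A) (y : A) :
    toDual K A (c • f) y = c * toDual K A f y := rfl

theorem toDual_ext {f g : DualBimodule K A} (h : ∀ y, toDual K A f y = toDual K A g y) : f = g :=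
  LinearMap.ext (f := toDual K A f) (g := toDual K A g) h

/-- Evaluation of a functional in the dual bimodule, as a linear map. -/
noncomputable def eval (y : A) : DualBimodule K A →ₗ[K] K where
  toFun f := toDual K A f y
  map_add' _ _ := rfl
  map_smul' _ _ := rfl

end DualBimodule

section TrivialExtensionPresentation

open DualBimodule

variable {K Λ B : Type*} [Field K] [Ring Λ] [Algebra K Λ] [Ring B] [Algebra K B]
  {e α : Fin 2 → Λ} {e' α' c : Fin 2 → B}

/-- The two arrows give the same maximal path, so its index can be changed to one that differs from
the index of the neighbouring factor. -/
theorem KroneckerDualRel.mul_mul_eq_zero (hd : KroneckerDualRel e' α' c)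
    (k l m : Fin 2) : α' k * (c l * α' m) = 0 ∧ c k * (α' l * c m) = 0 := by
  have key : ∀ k : Fin 2, ∃ n, n ≠ k := by decide
  have h1 : ∀ k, α' k * (c 0 * α' 0) = 0 ∧ c k * (α' 0 * c 0) = 0 := by
    intro k
    obtain ⟨n, hn⟩ := key k
    constructor
    · rw [← (hd.c_mul_α n n).trans (if_pos rfl), ← mul_assoc, hd.α_mul_c, if_neg hn.symm, zero_mul]
    · rw [← (hd.α_mul_c n n).trans (if_pos rfl), ← mul_assoc, hd.c_mul_α, if_neg hn.symm, zero_mul]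
  rw [hd.c_mul_α, hd.α_mul_c]
  constructor <;> split_ifs <;> simp [h1 k]

/-- The image of a functional on the Kronecker algebra. -/
noncomputable def dualMap (e α : Fin 2 → Λ) (α' c : Fin 2 → B) : DualBimodule K Λ →ₗ[K] B :=
  -- In the basis dual to `e`, `α`, the functional dual to `α k` goes to `c k`, while `α 0 * c 0`
  -- and `c 0 * α 0` correspond to the functionals dual to `e 0` and `e 1`.
  (eval (α 0)).smulRight (c 0) + (eval (α 1)).smulRight (c 1) +
    (eval (e 0)).smulRight (α' 0 * c 0) + (eval (e 1)).smulRight (c 0 * α' 0)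

theorem dualMap_apply (f : DualBimodule K Λ) : dualMap e α α' c f =
    toDual K Λ f (α 0) • c 0 + toDual K Λ f (α 1) • c 1 + toDual K Λ f (e 0) • (α' 0 * c 0) +
      toDual K Λ f (e 1) • (c 0 * α' 0) := rfl

theorem dualMap_mul_dualMap (h' : KroneckerRel e' α') (hd : KroneckerDualRel e' α' c)
    (f g : DualBimodule K Λ) : dualMap e α α' c f * dualMap e α α' c g = 0 := by
  have h1 : ∀ k l, c k * c l = 0 := by
    intro k l
    have h2 := (hd.c_mul_e k 0).trans (if_pos rfl)
    have h3 := (hd.e_mul_c 0 l).trans (if_neg zero_ne_one)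
    rw [← h2, mul_assoc, h3, mul_zero]
  have h3 := fun k l m => (hd.mul_mul_eq_zero k l m).2
  have h4 : ∀ k l z, c k * (c l * z) = 0 := fun k l z => by rw [← mul_assoc, h1, zero_mul]
  have h5 : ∀ k l m z, c k * (α' l * (c m * z)) = 0 := fun k l m z => by
    rw [← mul_assoc (α' l), ← mul_assoc, h3, zero_mul]
  have h6 : ∀ k l z, α' k * (α' l * z) = 0 := fun k l z => by
    rw [← mul_assoc, h'.α_mul_α, zero_mul]
  simp only [dualMap_apply, add_mul, mul_add, smul_mul_assoc, mul_smul_comm, mul_assoc, h1, h3,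
    h4, h5, h6, smul_zero, mul_zero, add_zero]

theorem dualMap_smul (h : KroneckerRel e α)
    (hgen : Algebra.adjoin K (Set.range e ∪ Set.range α) = ⊤)
    (i : Λ →ₐ[K] B) (h' : KroneckerRel e' α') (hd : KroneckerDualRel e' α' c)
    (hie : ∀ k, i (e k) = e' k) (hiα : ∀ k, i (α k) = α' k) (r : Λ) (f : DualBimodule K Λ) :
    dualMap e α α' c (r • f) = i r * dualMap e α α' c f := by
  have h2 := fun k => (hd.mul_mul_eq_zero k 0 0).1
  have h3 : ∀ k, α' k * (α' 0 * c 0) = 0 := fun k => by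
    rw [← mul_assoc, h'.α_mul_α, zero_mul]
  refine KroneckerRel.apply_eq h hgen
    (f := (dualMap e α α' c).comp (LinearMap.toSpanSingleton Λ _ f |>.restrictScalars K))
    (g := (LinearMap.mulRight K (dualMap e α α' c f)).comp i.toLinearMap) (fun k => ?_)
    (fun k => ?_) r
  · change dualMap e α α' c (e k • f) = i (e k) * dualMap e α α' c f
    simp only [dualMap_apply, DualBimodule.toDual_smul, hie, h.e_mul_e, h.α_mul_e, mul_add, mul_smul_comm,
      ← mul_assoc, h'.e_mul_α, hd.e_mul_c]
    fin_cases k <;> simp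
  · change dualMap e α α' c (α k • f) = i (α k) * dualMap e α α' c f
    simp only [dualMap_apply, DualBimodule.toDual_smul, hiα, h.e_mul_α, h.α_mul_α, mul_add,
      mul_smul_comm, h2, h3]
    rw [hd.α_mul_c k 0, hd.α_mul_c k 1]
    fin_cases k <;> simp

theorem dualMap_op_smul (h : KroneckerRel e α)
    (hgen : Algebra.adjoin K (Set.range e ∪ Set.range α) = ⊤)
    (i : Λ →ₐ[K] B) (h' : KroneckerRel e' α') (hd : KroneckerDualRel e' α' c)
    (hie : ∀ k, i (e k) = e' k) (hiα : ∀ k, i (α k) = α' k) (r : Λ) (f : DualBimodule K Λ) :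
    dualMap e α α' c (MulOpposite.op r • f) = dualMap e α α' c f * i r := by
  have h2 := fun k => (mul_assoc _ _ _).trans (hd.mul_mul_eq_zero 0 0 k).1
  have h3 : ∀ k, c 0 * α' 0 * α' k = 0 := fun k => by
    rw [mul_assoc, h'.α_mul_α, mul_zero]
  let L : Λ →ₗ[K] DualBimodule K Λ :=
    { toFun := fun r => MulOpposite.op r • f
      map_add' := fun r s => by rw [MulOpposite.op_add, add_smul]
      map_smul' := fun k r => by
        rw [MulOpposite.op_smul, smul_assoc]
        rfl }
  refine KroneckerRel.apply_eq h hgen (f := (dualMap e α α' c).comp L)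
    (g := (LinearMap.mulLeft K (dualMap e α α' c f)).comp i.toLinearMap) (fun k => ?_)
    (fun k => ?_) r
  · change dualMap e α α' c (MulOpposite.op (e k) • f) = dualMap e α α' c f * i (e k)
    simp only [dualMap_apply, DualBimodule.toDual_op_smul, hie, h.e_mul_e, h.e_mul_α, add_mul, smul_mul_assoc,
      mul_assoc, h'.α_mul_e, hd.c_mul_e]
    fin_cases k <;> simp
  · change dualMap e α α' c (MulOpposite.op (α k) • f) = dualMap e α α' c f * i (α k)
    simp only [dualMap_apply, DualBimodule.toDual_op_smul, hiα, h.α_mul_e, h.α_mul_α, add_mul,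
      smul_mul_assoc, h2, h3]
    rw [hd.c_mul_α 0 k, hd.c_mul_α 1 k]
    fin_cases k <;> simp

/-- A presentation of the trivial extension of the Kronecker algebra. -/
theorem nonempty_algEquiv_trivialExtension (h : KroneckerRel e α)
    (hgen : Algebra.adjoin K (Set.range e ∪ Set.range α) = ⊤)
    (φ : Fin 2 → DualBimodule K Λ) (hφe : ∀ k i, toDual K Λ (φ k) (e i) = 0)
    (hφα : ∀ k l, toDual K Λ (φ k) (α l) = if l = k then 1 else 0)
    (i : Λ →ₐ[K] B) (h' : KroneckerRel e' α') (hd : KroneckerDualRel e' α' c)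
    (hie : ∀ k, i (e k) = e' k) (hiα : ∀ k, i (α k) = α' k)
    (hB : Algebra.adjoin K (Set.range e' ∪ Set.range α' ∪ Set.range c) = ⊤)
    (f : B →ₐ[K] TrivialExtension K Λ) (hfe : ∀ k, f (e' k) = TrivSqZeroExt.inl (e k))
    (hfα : ∀ k, f (α' k) = TrivSqZeroExt.inl (α k))
    (hfc : ∀ k, f (c k) = TrivSqZeroExt.inr (φ k)) :
    Nonempty (B ≃ₐ[K] TrivialExtension K Λ) := by
  let g : TrivialExtension K Λ →ₐ[K] B := TrivSqZeroExt.lift i (dualMap e α α' c)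
    (dualMap_mul_dualMap h' hd) (dualMap_smul h hgen i h' hd hie hiα)
    (dualMap_op_smul h hgen i h' hd hie hiα)
  have hgl : ∀ r, g (TrivSqZeroExt.inl r) = i r := TrivSqZeroExt.lift_apply_inl _ _ _ _ _
  have hgr : ∀ m, g (TrivSqZeroExt.inr m) = dualMap e α α' c m :=
    TrivSqZeroExt.lift_apply_inr _ _ _ _ _
  refine ⟨AlgEquiv.ofAlgHom f g ?_ ?_⟩
  · refine TrivSqZeroExt.algHom_ext' ?_ ?_
    · ext r : 1
      change f (g (TrivSqZeroExt.inl r)) = TrivSqZeroExt.inl r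
      rw [hgl]
      exact KroneckerRel.apply_eq h hgen (f := (f.comp i).toLinearMap)
        (g := (TrivSqZeroExt.inlAlgHom K Λ (DualBimodule K Λ)).toLinearMap)
        (fun k => by
          change f (i (e k)) = TrivSqZeroExt.inl (e k)
          rw [hie, hfe])
        (fun k => by
          change f (i (α k)) = TrivSqZeroExt.inl (α k)
          rw [hiα, hfα]) r
    · ext m : 1
      change f (g (TrivSqZeroExt.inr m)) = TrivSqZeroExt.inr m
      rw [hgr, dualMap_apply, map_add, map_add, map_add, map_smul, map_smul, map_smul, map_smul,
        map_mul, map_mul, hfc, hfc, hfα, TrivSqZeroExt.inl_mul_inr, TrivSqZeroExt.inr_mul_inl,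
        ← TrivSqZeroExt.inr_smul, ← TrivSqZeroExt.inr_smul, ← TrivSqZeroExt.inr_smul,
        ← TrivSqZeroExt.inr_smul, ← TrivSqZeroExt.inr_add, ← TrivSqZeroExt.inr_add,
        ← TrivSqZeroExt.inr_add]
      congr 1
      refine DualBimodule.toDual_ext fun y => ?_
      refine KroneckerRel.apply_eq h hgen (f := toDual K Λ _) (g := toDual K Λ m)
        (fun k => ?_) (fun k => ?_) y
      · simp only [DualBimodule.toDual_add, DualBimodule.toDual_base_smul, DualBimodule.toDual_smul, DualBimodule.toDual_op_smul, h.e_mul_α, h.α_mul_e,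
          hφe]
        fin_cases k <;> simp [hφα]
      · simp only [DualBimodule.toDual_add, DualBimodule.toDual_base_smul, DualBimodule.toDual_smul, DualBimodule.toDual_op_smul, h.α_mul_α, hφα]
        fin_cases k <;> simp
  · refine AlgHom.ext_of_adjoin_eq_top hB ?_
    rintro _ ((⟨k, rfl⟩ | ⟨k, rfl⟩) | ⟨k, rfl⟩)
    · change g (f (e' k)) = e' k
      rw [hfe, hgl, hie]
    · change g (f (α' k)) = α' k
      rw [hfα, hgl, hiα]
    · change g (f (c k)) = c k
      rw [hfc, hgr, dualMap_apply, hφe, hφe, hφα, hφα]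
      fin_cases k <;> simp

end TrivialExtensionPresentation

theorem kroneckerRel_trivialExtension {K Λ : Type*} [Field K] [Ring Λ] [Algebra K Λ]
    {e α : Fin 2 → Λ} (h : KroneckerRel e α) :
    KroneckerRel (fun i => (TrivSqZeroExt.inl (e i) : TrivialExtension K Λ))
      (fun k => TrivSqZeroExt.inl (α k)) := by
  refine ⟨fun i j => ?_, ?_, fun i k => ?_, fun k i => ?_⟩
  · rw [TrivSqZeroExt.inl_mul_inl, h.e_mul_e]
    split_ifs <;> simp
  · have h1 := congrArg (TrivSqZeroExt.inlHom Λ (DualBimodule K Λ)) h.sum_e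
    rwa [map_sum, map_one] at h1
  · rw [TrivSqZeroExt.inl_mul_inl, h.e_mul_α]
    split_ifs <;> simp
  · rw [TrivSqZeroExt.inl_mul_inl, h.α_mul_e]
    split_ifs <;> simp

open DualBimodule in
theorem kroneckerDualRel_trivialExtension {K Λ : Type*} [Field K] [Ring Λ] [Algebra K Λ]
    {e α : Fin 2 → Λ} (h : KroneckerRel e α)
    (hgen : Algebra.adjoin K (Set.range e ∪ Set.range α) = ⊤)
    (φ : Fin 2 → DualBimodule K Λ) (hφe : ∀ k i, toDual K Λ (φ k) (e i) = 0)
    (hφα : ∀ k l, toDual K Λ (φ k) (α l) = if l = k then 1 else 0) :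
    KroneckerDualRel (fun i => (TrivSqZeroExt.inl (e i) : TrivialExtension K Λ))
      (fun k => TrivSqZeroExt.inl (α k)) (fun k => TrivSqZeroExt.inr (φ k)) := by
  have hext : ∀ f g : DualBimodule K Λ, (∀ i, toDual K Λ f (e i) = toDual K Λ g (e i)) →
      (∀ k, toDual K Λ f (α k) = toDual K Λ g (α k)) → f = g := fun f g h1 h2 =>
    DualBimodule.toDual_ext fun y => KroneckerRel.apply_eq h hgen h1 h2 y
  refine ⟨fun i k => ?_, fun k i => ?_, fun k l => ?_, fun k l => ?_⟩
  · rw [TrivSqZeroExt.inl_mul_inr, ← TrivSqZeroExt.inr_zero, ← apply_ite TrivSqZeroExt.inr]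
    congr 1
    refine hext _ _ (fun j => ?_) (fun l => ?_)
    · rw [DualBimodule.toDual_smul, h.e_mul_e]
      split_ifs <;> simp [hφe, DualBimodule.toDual_zero]
    · rw [DualBimodule.toDual_smul, h.α_mul_e]
      split_ifs <;> simp [DualBimodule.toDual_zero]
  · rw [TrivSqZeroExt.inr_mul_inl, ← TrivSqZeroExt.inr_zero, ← apply_ite TrivSqZeroExt.inr]
    congr 1
    refine hext _ _ (fun j => ?_) (fun l => ?_)
    · rw [DualBimodule.toDual_op_smul, h.e_mul_e]
      split_ifs <;> simp [hφe, DualBimodule.toDual_zero]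
    · rw [DualBimodule.toDual_op_smul, h.e_mul_α]
      split_ifs <;> simp [DualBimodule.toDual_zero]
  · rw [TrivSqZeroExt.inl_mul_inr, TrivSqZeroExt.inl_mul_inr, ← TrivSqZeroExt.inr_zero,
      ← apply_ite TrivSqZeroExt.inr]
    congr 1
    refine hext _ _ (fun j => ?_) (fun m => ?_)
    · rw [DualBimodule.toDual_smul, h.e_mul_α]
      fin_cases j <;> fin_cases k <;> fin_cases l <;>
        simp [DualBimodule.toDual_zero, DualBimodule.toDual_smul, h.e_mul_α, hφα]
    · rw [DualBimodule.toDual_smul, h.α_mul_α]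
      split_ifs <;> simp [DualBimodule.toDual_zero, DualBimodule.toDual_smul, h.α_mul_α]
  · rw [TrivSqZeroExt.inr_mul_inl, TrivSqZeroExt.inr_mul_inl, ← TrivSqZeroExt.inr_zero,
      ← apply_ite TrivSqZeroExt.inr]
    congr 1
    refine hext _ _ (fun j => ?_) (fun m => ?_)
    · rw [DualBimodule.toDual_op_smul, h.α_mul_e]
      fin_cases j <;> fin_cases k <;> fin_cases l <;>
        simp [DualBimodule.toDual_zero, DualBimodule.toDual_op_smul, h.α_mul_e, hφα]
    · rw [DualBimodule.toDual_op_smul, h.α_mul_α]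
      split_ifs <;> simp [DualBimodule.toDual_zero, DualBimodule.toDual_op_smul, h.α_mul_α]

/-! ### Pairs of parallel arrows of length two. -/

namespace BrauerGraph

variable {V E : Type} {G : BrauerGraph V E}

/-- Two edges between two vertices of valency two and multiplicity one, in terms of two parallel
arrows. -/
structure IsDoubleEdge (a b : G.Arrow) : Prop where
  ne : a ≠ b
  src_eq : a.src = b.src
  tgt_eq : a.tgt = b.tgt
  src_ne_tgt : a.src ≠ a.tgt
  len_left : G.len a.1 = 2
  len_right : G.len b.1 = 2

namespace IsDoubleEdge

variable {a b : G.Arrow}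

theorem next_ne_next (h : IsDoubleEdge a b) : a.next ≠ b.next :=
  fun H => h.ne (Arrow.next_injective H)

theorem right_eq (h : IsDoubleEdge a b) : b.1 = flip a.1 := eq_flip_of_src_eq h.ne h.src_eq

theorem next_right_eq (h : IsDoubleEdge a b) : b.next.1 = flip a.next.1 :=
  eq_flip_of_src_eq h.next_ne_next h.tgt_eq

variable [Fintype E]

theorem next_next_left (h : IsDoubleEdge a b) : a.next.next = a := by
  have := a.iterate_next_len
  rwa [h.len_left] at this

theorem next_next_right (h : IsDoubleEdge a b) : b.next.next = b := by
  have := b.iterate_next_len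
  rwa [h.len_right] at this

/-- These four half-edges are closed under `flip` and, as the lengths are two, under `next`;
connectedness does the rest. -/
theorem half_edge_cases (h : IsDoubleEdge a b) (x : E × Bool) :
    x = a.1 ∨ x = b.1 ∨ x = a.next.1 ∨ x = b.next.1 := by
  refine G.half_edge_induction (fun x => x = a.1 ∨ x = b.1 ∨ x = a.next.1 ∨ x = b.next.1)
    (Or.inl rfl) ?_ ?_ x
  · rintro _ (rfl | rfl | rfl | rfl)
    · exact Or.inr (Or.inl h.right_eq.symm)
    · exact Or.inl (by rw [h.right_eq, flip_flip])
    · exact Or.inr (Or.inr (Or.inr h.next_right_eq.symm))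
    · exact Or.inr (Or.inr (Or.inl (by rw [h.next_right_eq, flip_flip])))
  · rintro _ (rfl | rfl | rfl | rfl)
    · exact Or.inr (Or.inr (Or.inl rfl))
    · exact Or.inr (Or.inr (Or.inr rfl))
    · exact Or.inl (congrArg Subtype.val h.next_next_left)
    · exact Or.inr (Or.inl (congrArg Subtype.val h.next_next_right))

theorem arrow_cases (h : IsDoubleEdge a b) (p : G.Arrow) :
    p = a ∨ p = b ∨ p = a.next ∨ p = b.next := by
  rcases h.half_edge_cases p.1 with H | H | H | H
  · exact Or.inl (Arrow.ext' H)
  · exact Or.inr (Or.inl (Arrow.ext' H))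
  · exact Or.inr (Or.inr (Or.inl (Arrow.ext' H)))
  · exact Or.inr (Or.inr (Or.inr (Arrow.ext' H)))

theorem edge_cases (h : IsDoubleEdge a b) (k : E) : k = a.src ∨ k = a.tgt := by
  rcases h.half_edge_cases (k, false) with H | H | H | H
  · exact Or.inl (congrArg Prod.fst H)
  · exact Or.inl ((congrArg Prod.fst H).trans h.src_eq.symm)
  · exact Or.inr (congrArg Prod.fst H)
  · exact Or.inr ((congrArg Prod.fst H).trans h.tgt_eq.symm)

theorem len_eq (h : IsDoubleEdge a b) (p : G.Arrow) : G.len p.1 = 2 := by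
  have hn : ∀ q : G.Arrow, G.len q.next.1 = G.len q.1 := fun q => by
    rw [len, len, Arrow.next_val, G.endpoint_next]
  rcases h.arrow_cases p with rfl | rfl | rfl | rfl
  · exact h.len_left
  · exact h.len_right
  · rw [hn, h.len_left]
  · rw [hn, h.len_right]

theorem next_tgt_left (h : IsDoubleEdge a b) : a.next.tgt = a.src := by
  rw [← Arrow.src_next, h.next_next_left]

theorem next_tgt_right (h : IsDoubleEdge a b) : b.next.tgt = a.src := by
  rw [← Arrow.src_next, h.next_next_right, h.src_eq]

/-- The Brauer graph algebra of a double edge maps to every algebra satisfying the relations of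
the trivial extension of the Kronecker algebra. -/
theorem exists_lift (h : IsDoubleEdge a b) {K B : Type*} [Field K] [Ring B] [Algebra K B]
    {e α c : Fin 2 → B} (h1 : KroneckerRel e α) (h2 : KroneckerDualRel e α c) :
    ∃ f : G.Alg K →ₐ[K] B, f (G.idem K a.src) = e 0 ∧ f (G.idem K a.tgt) = e 1 ∧
      f (G.arrow K a) = α 0 ∧ f (G.arrow K b) = α 1 ∧
      f (G.arrow K a.next) = c 0 ∧ f (G.arrow K b.next) = c 1 := by
  classical
  have hca : a.next ≠ a := fun H => h.src_ne_tgt (congrArg Arrow.src H).symm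
  have hcb : a.next ≠ b := fun H => h.src_ne_tgt (h.src_eq.trans (congrArg Arrow.src H).symm)
  have hda : b.next ≠ a := fun H =>
    h.src_ne_tgt ((congrArg Arrow.src H).symm.trans h.tgt_eq.symm)
  have hdb : b.next ≠ b := fun H =>
    h.src_ne_tgt (h.src_eq.trans ((congrArg Arrow.src H).symm.trans h.tgt_eq.symm))
  obtain ⟨e', he0, he1⟩ : ∃ e' : E → B, e' a.src = e 0 ∧ e' a.tgt = e 1 :=
    ⟨fun k => if k = a.src then e 0 else e 1, if_pos rfl, if_neg h.src_ne_tgt.symm⟩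
  obtain ⟨x, hxa, hxb, hxc, hxd⟩ : ∃ x : G.Arrow → B, x a = α 0 ∧ x b = α 1 ∧
      x a.next = c 0 ∧ x b.next = c 1 :=
    ⟨fun p => if p = a then α 0 else if p = b then α 1 else if p = a.next then c 0 else c 1,
      if_pos rfl, by simp [h.ne.symm], by simp [hca, hcb], by simp [hda, hdb, h.next_ne_next.symm]⟩
  have hcyc : ∀ p, Arrow.cyc x p (G.len p.1) =
      if p.src = a.src then α 0 * c 0 else c 0 * α 0 := by
    intro p
    rw [h.len_eq, Arrow.cyc_two]
    rcases h.arrow_cases p with rfl | rfl | rfl | rfl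
    · rw [if_pos rfl, hxa, hxc]
    · rw [if_pos h.src_eq.symm, hxb, hxd, h2.α_mul_c, if_pos rfl]
    · rw [if_neg (show ¬ a.next.src = a.src from h.src_ne_tgt.symm), h.next_next_left, hxa, hxc]
    · rw [if_neg (by rw [Arrow.src_next, ← h.tgt_eq]; exact h.src_ne_tgt.symm),
        h.next_next_right, hxb, hxd, h2.c_mul_α, if_pos rfl]
  let f : G.Alg K →ₐ[K] B := lift e' x
    (by
      intro i j
      rcases h.edge_cases i with rfl | rfl <;> rcases h.edge_cases j with rfl | rfl <;>
        simp [he0, he1, h1.e_mul_e, h.src_ne_tgt, h.src_ne_tgt.symm])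
    (by
      rw [Fintype.sum_eq_add a.src a.tgt h.src_ne_tgt, he0, he1, ← h1.sum_e, Fin.sum_univ_two]
      rintro k ⟨hk, hk'⟩
      exact absurd (h.edge_cases k) (by tauto))
    (by
      intro p
      rcases h.arrow_cases p with rfl | rfl | rfl | rfl
      · simp [hxa, he0, h1.e_mul_α]
      · simp [← h.src_eq, hxb, he0, h1.e_mul_α]
      · simp [Arrow.src_next, hxc, he1, h2.e_mul_c]
      · simp [Arrow.src_next, ← h.tgt_eq, hxd, he1, h2.e_mul_c])
    (by
      intro p
      rcases h.arrow_cases p with rfl | rfl | rfl | rfl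
      · simp [hxa, he1, h1.α_mul_e]
      · simp [← h.tgt_eq, hxb, he1, h1.α_mul_e]
      · simp [h.next_tgt_left, hxc, he0, h2.c_mul_e]
      · simp [h.next_tgt_right, hxd, he0, h2.c_mul_e])
    (by
      intro p q hpq
      rw [hcyc, hcyc]
      have : q.src = p.src := (congrArg Prod.fst hpq).trans (flip_fst _)
      rw [this])
    (by
      intro p hp
      refine absurd ?_ hp
      rcases h.arrow_cases p with rfl | rfl | rfl | rfl
      · exact h.right_eq ▸ b.2
      · rw [h.right_eq, flip_flip]
        exact a.2
      · exact h.next_right_eq ▸ b.next.2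
      · rw [h.next_right_eq, flip_flip]
        exact a.next.2)
    (by
      intro p q hpq
      rcases h.arrow_cases p with rfl | rfl | rfl | rfl
      · obtain rfl : q = b.next := Arrow.ext' (hpq.trans h.next_right_eq.symm)
        rw [hxa, hxd, h2.α_mul_c, if_neg zero_ne_one]
      · obtain rfl : q = a.next := Arrow.ext' (hpq.trans (by
          rw [← Arrow.next_val, h.next_right_eq, flip_flip]))
        rw [hxb, hxc, h2.α_mul_c, if_neg one_ne_zero]
      · obtain rfl : q = b := Arrow.ext' (hpq.trans (by
          rw [← Arrow.next_val, h.next_next_left, h.right_eq]))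
        rw [hxc, hxb, h2.c_mul_α, if_neg zero_ne_one]
      · obtain rfl : q = a := Arrow.ext' (hpq.trans (by
          rw [← Arrow.next_val, h.next_next_right, h.right_eq, flip_flip]))
        rw [hxd, hxa, h2.c_mul_α, if_neg one_ne_zero])
  have hfe : ∀ k, f (G.idem K k) = e' k := fun k => lift_idem ..
  have hfx : ∀ p, f (G.arrow K p) = x p := fun p => lift_arrow ..
  exact ⟨f, (hfe _).trans he0, (hfe _).trans he1, (hfx _).trans hxa, (hfx _).trans hxb,
    (hfx _).trans hxc, (hfx _).trans hxd⟩

theorem kroneckerRel (h : IsDoubleEdge a b) (K : Type*) [Field K] :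
    KroneckerRel ![G.idem K a.src, G.idem K a.tgt] ![G.arrow K a, G.arrow K b] := by
  classical
  refine ⟨fun i j => ?_, ?_, fun i k => ?_, fun k i => ?_⟩
  · fin_cases i <;> fin_cases j <;>
      simp [idem_mul_idem, h.src_ne_tgt, h.src_ne_tgt.symm]
  · rw [Fin.sum_univ_two, ← G.sum_idem K, Fintype.sum_eq_add a.src a.tgt h.src_ne_tgt]
    · rfl
    · rintro k ⟨hk, hk'⟩
      exact absurd (h.edge_cases k) (by tauto)
  · fin_cases i <;> fin_cases k <;> simp [idem_mul_arrow, h.src_eq, h.tgt_eq]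
    · exact fun H => absurd (h.src_eq.trans (H.symm.trans h.tgt_eq.symm)) h.src_ne_tgt
    · exact fun H => absurd (h.src_eq.trans (H.symm.trans h.tgt_eq.symm)) h.src_ne_tgt
  · fin_cases i <;> fin_cases k <;> simp [arrow_mul_idem, h.src_eq, h.tgt_eq]
    · exact fun H => absurd (h.src_eq.trans (H.symm.trans h.tgt_eq.symm)) h.src_ne_tgt
    · exact fun H => absurd (h.src_eq.trans (H.symm.trans h.tgt_eq.symm)) h.src_ne_tgt

theorem kroneckerDualRel (h : IsDoubleEdge a b) (K : Type*) [Field K] :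
    KroneckerDualRel ![G.idem K a.src, G.idem K a.tgt] ![G.arrow K a, G.arrow K b]
      ![G.arrow K a.next, G.arrow K b.next] := by
  classical
  have hne : b.src ≠ b.tgt := h.src_eq ▸ h.tgt_eq ▸ h.src_ne_tgt
  have h1 := G.cyc_eq_cyc K a b h.right_eq
  have h2 := G.cyc_eq_cyc K a.next b.next h.next_right_eq
  rw [h.len_eq, h.len_eq, Arrow.cyc_two, Arrow.cyc_two] at h1 h2
  rw [h.next_next_left, h.next_next_right] at h2
  have h3 : G.arrow K a * G.arrow K b.next = 0 :=
    G.arrow_mul_arrow_of_ne K h.next_ne_next.symm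
  have h4 : G.arrow K b * G.arrow K a.next = 0 := G.arrow_mul_arrow_of_ne K h.next_ne_next
  have h5 : G.arrow K a.next * G.arrow K b = 0 :=
    G.arrow_mul_arrow_of_ne K (by rw [h.next_next_left]; exact h.ne.symm)
  have h6 : G.arrow K b.next * G.arrow K a = 0 :=
    G.arrow_mul_arrow_of_ne K (by rw [h.next_next_right]; exact h.ne)
  refine ⟨fun i k => ?_, fun k i => ?_, fun k l => ?_, fun k l => ?_⟩
  · fin_cases i <;> fin_cases k <;>
      simp [idem_mul_arrow, Arrow.src_next, h.src_eq, h.tgt_eq, hne]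
  · fin_cases i <;> fin_cases k <;>
      simp [arrow_mul_idem, h.next_tgt_left, h.next_tgt_right, h.src_eq, h.tgt_eq, hne]
  · fin_cases k <;> fin_cases l <;> simp [h1, h3, h4]
  · fin_cases k <;> fin_cases l <;> simp [h2, h5, h6]

/-- The arrows `a`, `b` play the role of the Kronecker arrows, and their successors that of the dual
functionals. -/
theorem nonempty_algEquiv (h : IsDoubleEdge a b) (K : Type u) [Field K] :
    Nonempty (G.Alg K ≃ₐ[K] TrivialExtension K (KroneckerAlgebra K)) := by
  choose φ hφe hφα using KroneckerRel.exists_dual K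
  have hstd := KroneckerRel.std K
  have hgen := KroneckerRel.adjoin_std K
  have hrel := h.kroneckerRel K
  obtain ⟨i, hie, hiα⟩ := KroneckerRel.exists_lift (K := K) hrel
  obtain ⟨f, h1, h2, h3, h4, h5, h6⟩ := h.exists_lift (K := K)
    (kroneckerRel_trivialExtension (K := K) hstd)
    (kroneckerDualRel_trivialExtension (K := K) hstd hgen φ hφe hφα)
  refine nonempty_algEquiv_trivialExtension (K := K) hstd hgen φ hφe hφα i hrel
    (h.kroneckerDualRel K) hie hiα ?_ f ?_ ?_ ?_
  · rw [eq_top_iff, ← G.adjoin_eq_top K]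
    refine Algebra.adjoin_mono ?_
    rintro _ (⟨k, rfl⟩ | ⟨p, rfl⟩)
    · rcases h.edge_cases k with rfl | rfl
      · exact Or.inl (Or.inl ⟨0, rfl⟩)
      · exact Or.inl (Or.inl ⟨1, rfl⟩)
    · rcases h.arrow_cases p with rfl | rfl | rfl | rfl
      · exact Or.inl (Or.inr ⟨0, rfl⟩)
      · exact Or.inl (Or.inr ⟨1, rfl⟩)
      · exact Or.inr ⟨0, rfl⟩
      · exact Or.inr ⟨1, rfl⟩
  · intro k
    fin_cases k
    · exact h1
    · exact h2
  · intro k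
    fin_cases k
    · exact h3
    · exact h4
  · intro k
    fin_cases k
    · exact h5
    · exact h6

end IsDoubleEdge

/-- Two parallel loops in maximal paths of length two. -/
theorem local_of_parallel_loops [Finite E] {a b : G.Arrow} (hab : a ≠ b) (hs : a.src = b.src)
    (hloop : a.src = a.tgt) (ht : a.tgt = b.tgt) :
    Subsingleton E ∧ ∀ p : G.Arrow, p = a ∨ p = b := by
  have hb : b.1 = flip a.1 := eq_flip_of_src_eq hab hs
  have key : ∀ x, x = a.1 ∨ x = flip a.1 := by
    refine G.half_edge_induction _ (Or.inl rfl) ?_ ?_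
    · rintro _ (rfl | rfl)
      · exact Or.inr rfl
      · exact Or.inl (flip_flip _)
    · rintro _ (rfl | rfl)
      · exact eq_or_eq_flip_of_fst_eq hloop.symm
      · have h := eq_or_eq_flip_of_fst_eq (h := a.1) (h' := G.next b.1) (ht.symm.trans hloop.symm)
        rwa [hb] at h
  have hE : ∀ i : E, i = a.src := by
    intro i
    rcases key (i, false) with h | h
    · exact congrArg Prod.fst h
    · exact (congrArg Prod.fst h).trans (flip_fst _)
  refine ⟨⟨fun i j => (hE i).trans (hE j).symm⟩, fun p => ?_⟩
  rcases key p.1 with h | h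
  · exact Or.inl (Arrow.ext' h)
  · exact Or.inr (Arrow.ext' (h.trans hb.symm))

end BrauerGraph

/-! ### The main theorem. -/

theorem mainTheorem5 (K : Type u) [Field K] [IsAlgClosed K]
    (V E : Type) [Fintype E] (G : BrauerGraph V E)
    (hKronecker : ¬ (ringChar K ≠ 2 ∧
      DerivedEquivalent K (G.Alg K) (TrivialExtension K (KroneckerAlgebra K))))
    (hLoop : ¬ (ringChar K = 2 ∧ ∃ α : G.Arrow, α.src = α.tgt ∧ G.arrow K α ^ 2 = 0))
    (hTruncPoly : ¬ (ringChar K ≠ 2 ∧ ∃ r : ℕ, 0 < r ∧ ringChar K ∣ r ∧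
      Nonempty (G.Alg K ≃ₐ[K] K[X] ⧸ Ideal.span {(Polynomial.X : K[X]) ^ r}))) :
    LieAlgebra.IsSolvable (HH1 K (G.Alg K)) := by
  classical
  have htwo : ringChar K = 2 → (2 : K) = 0 := fun h => by
    have := ringChar.Nat.cast_ringChar (R := K)
    rwa [h, Nat.cast_ofNat] at this
  -- This is the truncated polynomial case, with exponent `G.len a.1 + 1`. Outside it derivations
  -- preserve the radical.
  by_cases hp : ∃ a : G.Arrow, G.next a.1 = a.1 ∧ ¬ G.IsArrow (BrauerGraph.flip a.1)
  · obtain ⟨a, ha, hf⟩ := hp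
    by_cases hn : ((G.len a.1 + 1 : ℕ) : K) = 0
    · by_cases hK : ringChar K = 2
      · exact isSolvable_HH1_of_adjoin_singleton (A := G.Alg K) (htwo hK)
          (BrauerGraph.adjoin_of_loop K ha hf)
      · exact absurd ⟨hK, _, Nat.succ_pos _, ringChar.dvd hn,
          ⟨BrauerGraph.equivTruncatedPolynomial K ha hf⟩⟩ hTruncPoly
    · exact BrauerGraph.isSolvable_of_loop K ha hf hn
  push Not at hp
  by_cases hK : ringChar K = 2
  · refine BrauerGraph.isSolvable_of_two_eq_zero (htwo hK) fun d hd _ a ha =>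
      BrauerGraph.augmentation_derivation_eq_zero (Or.inr fun a ha h0 => hLoop ⟨hK, a, ha, h0⟩)
        hp hd ha
  have h2 : (2 : K) ≠ 0 := Ring.two_ne_zero hK
  by_cases hex : ∃ a b : G.Arrow, a ≠ b ∧ a.src = b.src ∧ a.tgt = b.tgt ∧ G.len a.1 = 2 ∧
      G.len b.1 = 2
  · obtain ⟨a, b, hab, hs, ht, hla, hlb⟩ := hex
    -- Parallel loops force a local algebra; otherwise the graph is a double edge and the algebra is
    -- the excluded trivial extension.
    by_cases hloop : a.src = a.tgt
    · obtain ⟨hE, hcases⟩ := BrauerGraph.local_of_parallel_loops hab hs hloop ht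
      have hb := BrauerGraph.eq_flip_of_src_eq hab hs
      refine BrauerGraph.isSolvable_of_local h2 (fun p => ?_) (fun p => ?_)
      · rcases hcases p with rfl | rfl
        · exact hla
        · exact hlb
      · rcases hcases p with rfl | rfl
        · exact hb ▸ b.2
        · rw [hb, BrauerGraph.flip_flip]
          exact a.2
    · obtain ⟨φ⟩ := BrauerGraph.IsDoubleEdge.nonempty_algEquiv
        (⟨hab, hs, ht, hloop, hla, hlb⟩ : BrauerGraph.IsDoubleEdge a b) K
      exact absurd ⟨hK, derivedEquivalent_of_algEquiv φ⟩ hKronecker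
  · exact BrauerGraph.isSolvable_of_len_ne_two
      (fun d hd _ a ha => BrauerGraph.augmentation_derivation_eq_zero (Or.inl h2) hp hd ha)
      fun a b hab hs ht hla hlb => hex ⟨a, b, hab, hs, ht, hla, hlb⟩
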